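/- A $\mathsf{SUBCOND}$ oracle for a distribution $\mathcal D$ on $\{0,1\}^n$ takes a query string $\rho\in\{0,1,*\}^n$ and returns an independent sample from $\mathcal D$ conditioned on the subcube $S_\rho=\{w : w[i]=\rho[i]\text{ whenever }\rho[i]\neq *\}$ (if $\mathcal D(S_\rho)=0$, the sample may have an arbitrary law, depending only on $\rho$). Let $d_{TV}(\mathcal P,\mathcal Q)=\frac12\sum_{\sigma}|\mathcal P(\sigma)-\mathcal Q(\sigma)|$. For $\sigma\in\{0,1\}^n$ write $\mathcal D^{j}_{\sigma_{<j}}$ for the law of the $j$-th bit of the answer to the query $\sigma[1]\cdots\sigma[j-1]*\cdots*$. The procedure $\mathsf{SubToEval}(\mathcal D,\varepsilon,\sigma)$ sets $k=\lceil 4n/\varepsilon^2\rceil$, samples for each $j=1,\dots,n$ from $\mathcal D^j_{\sigma_{<j}}$ until $\sigma[j]$ has been seen $k$ times, lets $x_j$ be the number of samples used, and returns $\prod_{j=1}^n k/x_j$. The algorithm $\mathsf{SubVsSub}(\mathcal P,\mathcal Q,\varepsilon_1,\varepsilon_2)$ sets $$\gamma=\tfrac{\varepsilon_2-\varepsilon_1}{2},\quad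 m=\lceil 2^4\log(20)\gamma^{-2}\rceil,\quad t=\lceil 48\log(10m)\rceil,\quad M=10\Big(\tfrac{2^{10}n^3mt}{\gamma^3}+\tfrac{2^9n^2mt}{\gamma^2}\Big),$$ and, with $\theta=\gamma/(2n)$, simulates a sample from the $\theta$-tamed marginal $\mathcal P'^{\,j}_{\sigma_{<j}}=(1-2\theta)\mathcal P^{\,j}_{\sigma_{<j}}+2\theta\,\mathrm{Unif}\{0,1\}$ by one query to $\mathcal P$ whose $j$-th bit is replaced by a uniform bit with probability $2\theta$. For $i=1,\dots,m$ it draws $\sigma_i\sim\mathcal Q$, takes the medians $p_i$ and $q_i$ of $t$ runs each of $\mathsf{SubToEval}(\mathcal P',\gamma/8,\sigma_i)$ and $\mathsf{SubToEval}(\mathcal Q,\gamma/8,\sigma_i)$, and sets $\Gamma_i=1-p_i/q_i$ if $q_i>p_i$ and $\Gamma_i=0$ otherwise. It returns Accept if $\frac1m\sum_i\Gamma_i\le(\varepsilon_1+\varepsilon_2)/2$ and Reject otherwise; if it would need more than $M$ queries, it stops and returns Reject. Theorem. There are absolute constants $C$ and $c$ such that for all $n\ge 1$ and $0\le\varepsilon_1<\varepsilon_2\le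 1$ the following holds. 1. In every execution, $\mathsf{SubVsSub}(\mathcal P,\mathcal Q,\varepsilon_1,\varepsilon_2)$ makes at most $C\,X\,(\log(2+X))^{c}$ $\mathsf{SUBCOND}$ queries, where $X=n^3/(\varepsilon_2-\varepsilon_1)^5$; that is, at most $\tilde O\big(n^3/(\varepsilon_2-\varepsilon_1)^5\big)$ queries. 2. For all distributions $\mathcal P,\mathcal Q$ on $\{0,1\}^n$ and all $\mathsf{SUBCOND}$ oracles for them, the algorithm returns Accept with probability at least $3/5$ if $d_{TV}(\mathcal P,\mathcal Q)<\varepsilon_1$, and returns Reject with probability at least $3/5$ if $d_{TV}(\mathcal P,\mathcal Q)>\varepsilon_2$. -/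

import Mathlib

open scoped NNReal ENNReal

/-! ### The hypercube, subcubes and the subcube conditioning oracle -/

/-- The hypercube `{0,1}^n`. -/
abbrev Cube (n : ℕ) : Type := Fin n → Bool

/-- Query strings `ρ ∈ {0,1,*}^n`; the character `*` is `none`. -/
abbrev Query (n : ℕ) : Type := Fin n → Option Bool

/-- The subcube `S_ρ` of all strings that match the non-`*` characters of `ρ`. -/
def subcube {n : ℕ} (ρ : Query n) : Set (Cube n) :=
  {w | ∀ i, ∀ b, ρ i = some b → w i = b}

/-- `O` is (the law of the answers of) a subcube conditioning oracle for the distribution `D`: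
on the query `ρ` the answer is distributed as `D` conditioned on `S_ρ`.
The conditional distribution only exists if `D(S_ρ) > 0`; on a query `ρ` with `D(S_ρ) = 0`
nothing is demanded, the answer may have any law whatsoever. -/
def IsSubcondOracle {n : ℕ} (D : PMF (Cube n)) (O : Query n → PMF (Cube n)) : Prop :=
  ∀ (ρ : Query n) (h : ∃ w ∈ subcube ρ, w ∈ D.support), O ρ = D.filter (subcube ρ) h

/-- Total variation distance `½ ∑_σ |D₁(σ) - D₂(σ)|`. -/
noncomputable def tvDist {n : ℕ} (D₁ D₂ : PMF (Cube n)) : ℝ :=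
  1 / 2 * ∑ σ : Cube n, |(D₁ σ).toReal - (D₂ σ).toReal|

/-! ### Randomised algorithms with access to two subcube conditioning oracles -/

/-- The two distributions that an algorithm can query. -/
inductive Source : Type
  | P
  | Q

/-- Randomised algorithms that interact with two oracles on `{0,1}^n` and return a value in `α`:
either stop with a result, or ask one of the oracles a query and continue depending on the
answer, or toss a private coin that shows `true` with probability `p` and continue depending on
the outcome. -/
inductive OracleAlg (n : ℕ) (α : Type) : Type
  | done (a : α) : OracleAlg n α
  | query (s : Source) (ρ : Query n) (next : Cube n → OracleAlg n α) : OracleAlg n α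
  | coin (p : ℝ≥0) (hp : p ≤ 1) (next : Bool → OracleAlg n α) : OracleAlg n α

namespace OracleAlg

variable {n : ℕ} {α β : Type}

/-- Sequential composition. -/
def bind : OracleAlg n α → (α → OracleAlg n β) → OracleAlg n β
  | done a, f => f a
  | query s ρ next, f => query s ρ fun w => (next w).bind f
  | coin p hp next, f => coin p hp fun b => (next b).bind f

instance : Monad (OracleAlg n) where
  pure := done
  bind := bind

/-- The number of oracle queries in the worst case, over all answers of the oracles and all
outcomes of the private coins. -/
def maxQueries : OracleAlg n α → ℕ
  | done _ => 0
  | query _ _ next => 1 + Finset.univ.sup fun w => (next w).maxQueries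
  | coin _ _ next => Finset.univ.sup fun b => (next b).maxQueries

/-- The law of a coin that shows `true` with probability `p`. -/
noncomputable def coinLaw (p : ℝ≥0) (hp : p ≤ 1) : PMF Bool :=
  PMF.ofFintype (fun b => if b then (p : ℝ≥0∞) else ((1 - p : ℝ≥0) : ℝ≥0∞)) (by
    rw [Fintype.sum_bool]
    simp only [if_true, Bool.false_eq_true, if_false]
    exact_mod_cast add_tsub_cancel_of_le hp)

/-- The law of the result, when all oracle answers (with laws `O s ρ`) and all private coins are
drawn independently. -/
noncomputable def run (O : Source → Query n → PMF (Cube n)) : OracleAlg n α → PMF α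
  | done a => PMF.pure a
  | query s ρ next => (O s ρ).bind fun w => (next w).run O
  | coin p hp next => (coinLaw p hp).bind fun b => (next b).run O

end OracleAlg

/-! ### Algorithms with a bound on the number of calls

The state of a `Budgeted` computation is the number of calls (each of which will be one oracle
query) that it may still make. It breaks off (with `none`) as soon as it wants to make a call and none is left. -/

/-- Computations that keep track of the number of calls still allowed. -/
abbrev Budgeted (n : ℕ) (α : Type) : Type := StateT ℕ (OptionT (OracleAlg n)) α

/-- Perform `draw` as one call: break off if no call is left, otherwise use up one. -/
def call {n : ℕ} {α : Type} (draw : OracleAlg n α) : Budgeted n α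
  | 0 => OptionT.mk (.done none)
  | b + 1 => OptionT.mk (draw.bind fun a => .done (some (a, b)))

/-- The loop `while t < k do { x ← x + 1; α ∼ draw; if α = c then t ← t + 1 }; return x`, in which
every draw is a call. The last argument is the number of calls still allowed. -/
def countTrials {n : ℕ} (draw : OracleAlg n Bool) (c : Bool) (k : ℕ) :
    (x t : ℕ) → Budgeted n ℕ
  | x, t, 0 => OptionT.mk (if t < k then .done none else .done (some (x, 0)))
  | x, t, b + 1 =>
      if t < k then
        OptionT.mk (draw.bind fun α =>
          (countTrials draw c k (x + 1) (if α = c then t + 1 else t) b).run)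
      else OptionT.mk (.done (some (x, b + 1)))

/-! ### The tester -/

/-- The query string `σ[1] ⋯ σ[j-1] * ⋯ *`. -/
def prefixQuery {n : ℕ} (σ : Cube n) (j : Fin n) : Query n :=
  fun i => if i < j then some (σ i) else none

/-- A sample from the marginal `D^j_{σ_{<j}}`, where `D` is the distribution behind `s`. -/
def drawMarginal {n : ℕ} (s : Source) (σ : Cube n) (j : Fin n) : OracleAlg n Bool :=
  .query s (prefixQuery σ j) fun w => .done (w j)

/-- A sample from the marginal of the `θ`-tamed distribution `D'`: one from `D^j_{σ_{<j}}`, which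
with probability `2θ` is replaced by a uniform bit. (The minimum only serves to define the
algorithm for all real `θ`.) -/
noncomputable def drawTamedMarginal {n : ℕ} (θ : ℝ) (s : Source) (σ : Cube n) (j : Fin n) :
    OracleAlg n Bool :=
  .query s (prefixQuery σ j) fun w =>
    .coin (min 1 (2 * θ).toNNReal) (min_le_left _ _) fun tamed =>
      if tamed then .coin (1 / 2) (by norm_num) .done else .done (w j)

/-- `SubToEval(D, ε, σ)`: an estimate of `D(σ)`, where `draw σ j` samples from the marginal
`D^j_{σ_{<j}}`. For each `j`, `x_j` is the number of samples until `σ[j]` has been seen `k` times;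
the result is `∏_j k / x_j`. -/
noncomputable def subToEval {n : ℕ} (draw : Cube n → Fin n → OracleAlg n Bool) (ε : ℝ)
    (σ : Cube n) : Budgeted n ℝ := do
  let k : ℕ := ⌈4 * (n : ℝ) / ε ^ 2⌉₊
  let xs ← (List.finRange n).mapM' fun j => countTrials (draw σ j) (σ j) k 0 0
  return (xs.map fun x => (k : ℝ) / (x : ℝ)).prod

/-- The median of a list of reals (the upper one, if the length is even). -/
noncomputable def median (l : List ℝ) : ℝ :=
  (l.insertionSort (· ≤ ·)).getD (l.length / 2) 0

/-- The two possible outputs of a tester. -/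
inductive Verdict : Type
  | accept
  | reject

namespace SubVsSub

/-- `γ = (ε₂ - ε₁)/2`. -/
noncomputable def gap (ε₁ ε₂ : ℝ) : ℝ := (ε₂ - ε₁) / 2

/-- The number `m` of sample points: `2^4 log(20) γ^{-2}`, rounded up. -/
noncomputable def numSamples (γ : ℝ) : ℕ := ⌈2 ^ 4 * Real.log 20 / γ ^ 2⌉₊

/-- The number `t` of repetitions for the median trick: `48 log(10 m)`, rounded up. -/
noncomputable def numRepeats (γ : ℝ) : ℕ := ⌈48 * Real.log (10 * (numSamples γ : ℝ))⌉₊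

/-- The bound `M = 10 (2^10 n^3 m t / γ^3 + 2^9 n^2 m t / γ^2)` on the number of calls. -/
noncomputable def callBound (n : ℕ) (γ : ℝ) : ℝ :=
  10 * (2 ^ 10 * (n : ℝ) ^ 3 * numSamples γ * numRepeats γ / γ ^ 3
    + 2 ^ 9 * (n : ℝ) ^ 2 * numSamples γ * numRepeats γ / γ ^ 2)

/-- One round: draw `σ ∼ Q`, let `p` and `q` be the medians of `t` estimates of `P'(σ)` and of
`Q(σ)`, where `P'` is the `γ/(2n)`-tamed version of `P`, and return `1 - p/q` if `q > p` and `0`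
otherwise. -/
noncomputable def round (n : ℕ) (γ : ℝ) : Budgeted n ℝ := do
  let σ ← call (.query Source.Q (fun _ => none) .done)
  let pq ← (List.range (numRepeats γ)).mapM' fun _ => do
    let p ← subToEval (drawTamedMarginal (γ / (2 * n)) Source.P) (γ / 8) σ
    let q ← subToEval (drawMarginal Source.Q) (γ / 8) σ
    return (p, q)
  let p := median (pq.map Prod.fst)
  let q := median (pq.map Prod.snd)
  return if p < q then 1 - p / q else 0

/-- The mean of the results of `m` rounds. -/
noncomputable def estimate (n : ℕ) (γ : ℝ) : Budgeted n ℝ := do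
  let Γ ← (List.range (numSamples γ)).mapM' fun _ => round n γ
  return Γ.sum / numSamples γ

end SubVsSub

/-- The tester `SubVsSub(P, Q, ε₁, ε₂)`: compute the estimate with at most `M` calls; reject if
that does not suffice, otherwise accept if and only if the estimate is at most `(ε₁ + ε₂)/2`. -/
noncomputable def subVsSub (n : ℕ) (ε₁ ε₂ : ℝ) : OracleAlg n Verdict := do
  let γ := SubVsSub.gap ε₁ ε₂
  let result ← ((SubVsSub.estimate n γ).run ⌊SubVsSub.callBound n γ⌋₊).run
  match result with
  | none => return Verdict.reject
  | some (z, _) => return if z ≤ (ε₁ + ε₂) / 2 then Verdict.accept else Verdict.reject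

/-! If σ is drawn from Q, then the mean of max(0, 1 - P'(σ)/Q(σ)) is d_TV(P', Q) for every
distribution P'. Each round therefore estimates this distance from approximations to P'(σ) and Q(σ),
and a tester only has to come within γ of d_TV(P, Q), because the threshold lies in the middle of an
interval of length 2γ.

Accuracy. The number of trials until the k-th occurrence of a bit is negative binomial, so ∏ x_j/k
has mean 1/D(σ) and relative second moment at most (1 + 1/k)^n. Chebyshev's inequality makes one
estimate good up to a factor of about 1 ± γ/8 with probability 2/3 (`value_not_isClose_le_third`),
and the median makes failure exponentially rare in t (`CostLaw.value_half_bad_le`). Results of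
rounds lie in [0,1], so a rare failure just adds to the bias and no union bound over rounds is
needed. Taming moves d_TV by at most nθ = γ/2 (`abs_sum_mul_relDiff_sub_tvDist_le`). The total bias
is at most 0.77γ (`exists_value_roundLaw`), and Chebyshev's inequality for the mean of m rounds
costs the other 0.23γ.

Cost. Seeing a bit of probability q k times takes k/q draws on average. For P' taming gives q ≥
γ/(2n). For Q no taming is needed: since σ itself comes from Q, the mean of 1/q is at most 2
(`expect_inv_condProb_le`). The expected total is at most M/10, so by Markov's inequality the budget
M suffices with probability 9/10.

The budget is handled by analysing the unlimited computation: `CostLaw` is the joint law of its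
result and cost, and `HasLaw` says that a budget merely cuts off the outcomes that are too
expensive. The worst-case query bound is a separate, deterministic induction (`Frugal`). -/

/-! ### Expectations of nonnegative functions under a probability mass function -/

namespace PMF

variable {α β : Type*}

/-- The expectation of a nonnegative function. -/
noncomputable def expect (μ : PMF α) (f : α → ℝ≥0∞) : ℝ≥0∞ := ∑' a, μ a * f a

theorem expect_const (μ : PMF α) (c : ℝ≥0∞) : μ.expect (fun _ => c) = c := by
  rw [expect, ENNReal.tsum_mul_right, tsum_coe, one_mul]

theorem expect_mono (μ : PMF α) {f g : α → ℝ≥0∞} (h : ∀ a, f a ≤ g a) :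
    μ.expect f ≤ μ.expect g :=
  ENNReal.tsum_le_tsum fun a => mul_le_mul_right (h a) _

theorem expect_mono_support (μ : PMF α) {f g : α → ℝ≥0∞} (h : ∀ a ∈ μ.support, f a ≤ g a) :
    μ.expect f ≤ μ.expect g := by
  refine ENNReal.tsum_le_tsum fun a => ?_
  by_cases ha : μ a = 0
  · simp [ha]
  · exact mul_le_mul_right (h a ((mem_support_iff _ _).2 ha)) _

theorem expect_congr_support (μ : PMF α) {f g : α → ℝ≥0∞} (h : ∀ a ∈ μ.support, f a = g a) :
    μ.expect f = μ.expect g :=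
  le_antisymm (expect_mono_support _ fun a ha => (h a ha).le)
    (expect_mono_support _ fun a ha => (h a ha).ge)

theorem expect_add (μ : PMF α) (f g : α → ℝ≥0∞) :
    μ.expect (fun a => f a + g a) = μ.expect f + μ.expect g := by
  simp only [expect, mul_add, ENNReal.tsum_add]

theorem expect_const_mul (μ : PMF α) (c : ℝ≥0∞) (f : α → ℝ≥0∞) :
    μ.expect (fun a => c * f a) = c * μ.expect f := by
  simp only [expect, ← ENNReal.tsum_mul_left]
  exact tsum_congr fun a => by ring

theorem expect_mul_const (μ : PMF α) (c : ℝ≥0∞) (f : α → ℝ≥0∞) :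
    μ.expect (fun a => f a * c) = μ.expect f * c := by
  simp only [mul_comm _ c, expect_const_mul]

theorem expect_pure (a : α) (f : α → ℝ≥0∞) : (pure a).expect f = f a := by
  rw [expect, tsum_eq_single a]
  · simp
  · intro b hb
    simp [hb]

theorem expect_bind (μ : PMF α) (ν : α → PMF β) (f : β → ℝ≥0∞) :
    (μ.bind ν).expect f = μ.expect fun a => (ν a).expect f := by
  simp only [expect, bind_apply, ← ENNReal.tsum_mul_right, ← ENNReal.tsum_mul_left]
  rw [ENNReal.tsum_comm]
  exact tsum_congr fun a => tsum_congr fun b => by ring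

theorem expect_map (μ : PMF α) (g : α → β) (f : β → ℝ≥0∞) :
    (μ.map g).expect f = μ.expect fun a => f (g a) := by
  rw [map, expect_bind]
  simp only [Function.comp_apply, expect_pure]

theorem expect_bool (μ : PMF Bool) (c : Bool) (f : Bool → ℝ≥0∞) :
    μ.expect f = μ c * f c + μ (!c) * f (!c) := by
  rw [expect, tsum_fintype, Fintype.sum_bool]
  cases c <;> simp [add_comm]

theorem apply_eq_expect [DecidableEq α] (μ : PMF α) (a : α) :
    μ a = μ.expect fun b => if b = a then 1 else 0 := by
  rw [expect, tsum_eq_single a]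
  · simp
  · intro b hb
    simp [hb]

/-- Test functions are used to compare laws because recursions such as that of the negative binomial
law are most convenient as identities of expectations. -/
theorem ext_expect [DecidableEq α] {μ ν : PMF α} (h : ∀ f, μ.expect f = ν.expect f) : μ = ν := by
  ext a
  rw [apply_eq_expect, apply_eq_expect, h]

theorem bind_congr_support (μ : PMF α) {f g : α → PMF β} (h : ∀ a ∈ μ.support, f a = g a) :
    μ.bind f = μ.bind g := by
  ext b
  simp only [bind_apply]
  refine tsum_congr fun a => ?_
  by_cases ha : μ a = 0
  · simp [ha]
  · rw [h a ((mem_support_iff _ _).2 ha)]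

/-- Markov's inequality. -/
theorem expect_indicator_le (μ : PMF α) (s : α → Prop) [DecidablePred s] (f : α → ℝ≥0∞)
    (c : ℝ≥0∞) (h : ∀ a, s a → c ≤ f a) :
    μ.expect (fun a => if s a then 1 else 0) * c ≤ μ.expect f := by
  rw [← expect_mul_const]
  refine expect_mono _ fun a => ?_
  split_ifs with ha
  · simpa using h a ha
  · simp

end PMF

/-! ### Laws of a result together with its cost -/

/-- The law of a pair consisting of a result and the number of calls made to compute it. -/
abbrev CostLaw (α : Type) : Type := PMF (α × ℕ)

namespace CostLaw

variable {α β ι : Type}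

/-- Results that cost nothing. -/
noncomputable def pure (a : α) : CostLaw α := PMF.pure (a, 0)

/-- Sequential composition, adding up the costs. -/
noncomputable def bind (μ : CostLaw α) (ν : α → CostLaw β) : CostLaw β :=
  PMF.bind μ fun p => (ν p.1).map fun q => (q.1, p.2 + q.2)

/-- The expectation of a function of the result. -/
noncomputable def value (μ : CostLaw α) (f : α → ℝ≥0∞) : ℝ≥0∞ := PMF.expect μ fun p => f p.1

/-- The expected cost. -/
noncomputable def cost (μ : CostLaw α) : ℝ≥0∞ := PMF.expect μ fun p => (p.2 : ℝ≥0∞)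

theorem value_pure (a : α) (f : α → ℝ≥0∞) : (pure a).value f = f a := PMF.expect_pure _ _

theorem cost_pure (a : α) : (pure a).cost = 0 := by
  rw [cost, pure, PMF.expect_pure]
  simp

theorem value_bind (μ : CostLaw α) (ν : α → CostLaw β) (f : β → ℝ≥0∞) :
    (bind μ ν).value f = μ.value fun a => (ν a).value f := by
  simp only [value, bind, PMF.expect_bind, PMF.expect_map]

theorem cost_bind (μ : CostLaw α) (ν : α → CostLaw β) :
    (bind μ ν).cost = μ.cost + μ.value fun a => (ν a).cost := by
  simp only [value, cost, bind, PMF.expect_bind, PMF.expect_map, Nat.cast_add, PMF.expect_add,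
    PMF.expect_const]

theorem value_const (μ : CostLaw α) (c : ℝ≥0∞) : μ.value (fun _ => c) = c := PMF.expect_const _ _

theorem value_mono (μ : CostLaw α) {f g : α → ℝ≥0∞} (h : ∀ a, f a ≤ g a) :
    μ.value f ≤ μ.value g := PMF.expect_mono _ fun p => h p.1

theorem value_add (μ : CostLaw α) (f g : α → ℝ≥0∞) :
    μ.value (fun a => f a + g a) = μ.value f + μ.value g := PMF.expect_add _ _ _

theorem value_const_mul (μ : CostLaw α) (c : ℝ≥0∞) (f : α → ℝ≥0∞) :
    μ.value (fun a => c * f a) = c * μ.value f := PMF.expect_const_mul _ _ _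

theorem value_mul_const (μ : CostLaw α) (c : ℝ≥0∞) (f : α → ℝ≥0∞) :
    μ.value (fun a => f a * c) = μ.value f * c := PMF.expect_mul_const _ _ _

theorem value_indicator_le (μ : CostLaw α) (s : α → Prop) [DecidablePred s] (f : α → ℝ≥0∞)
    (c : ℝ≥0∞) (h : ∀ a, s a → c ≤ f a) :
    μ.value (fun a => if s a then 1 else 0) * c ≤ μ.value f :=
  PMF.expect_indicator_le _ (fun p : α × ℕ => s p.1) _ _ fun p => h p.1

/-- Independent computations, one for each element of a list. -/
noncomputable def mapList (ν : ι → CostLaw β) : List ι → CostLaw (List β)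
  | [] => pure []
  | a :: l => bind (ν a) fun b => bind (mapList ν l) fun bs => pure (b :: bs)

theorem value_mapList_cons (ν : ι → CostLaw β) (a : ι) (l : List ι) (F : List β → ℝ≥0∞) :
    (mapList ν (a :: l)).value F =
      (ν a).value fun b => (mapList ν l).value fun bs => F (b :: bs) := by
  simp only [mapList, value_bind, value_pure]

theorem cost_mapList (ν : ι → CostLaw β) (l : List ι) :
    (mapList ν l).cost = (l.map fun a => (ν a).cost).sum := by
  induction l with
  | nil => simp [mapList, cost_pure]
  | cons a l ih =>
    simp only [mapList, cost_bind, cost_pure, value_const, add_zero, ih, List.map_cons,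
      List.sum_cons]

/-- Independence: the expectation of a product factorises. It yields both the moments of the
estimates and the exponential moment behind the median trick. -/
theorem value_mapList_prod (ν : ι → CostLaw β) (g : β → ℝ≥0∞) (l : List ι) :
    (mapList ν l).value (fun bs => (bs.map g).prod) = (l.map fun a => (ν a).value g).prod := by
  induction l with
  | nil => simp [mapList, value_pure]
  | cons a l ih =>
    simp only [value_mapList_cons, List.map_cons, List.prod_cons, value_const_mul, ih,
      value_mul_const]

theorem value_mapList_sum (ν : ι → CostLaw β) (g : β → ℝ≥0∞) (l : List ι) :
    (mapList ν l).value (fun bs => (bs.map g).sum) = (l.map fun a => (ν a).value g).sum := by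
  induction l with
  | nil => simp [mapList, value_pure]
  | cons a l ih =>
    simp only [value_mapList_cons, List.map_cons, List.sum_cons, value_add, ih, value_const]

/-- `μ` is concentrated on results that satisfy `s`. -/
def Surely (μ : CostLaw α) (s : α → Prop) : Prop := ∀ p ∈ μ.support, s p.1

theorem Surely.pure {a : α} {s : α → Prop} (h : s a) : Surely (pure a) s := by
  intro p hp
  rw [CostLaw.pure, PMF.mem_support_pure_iff] at hp
  rwa [hp]

theorem Surely.bind {μ : CostLaw α} {ν : α → CostLaw β} {s : α → Prop} {r : β → Prop}
    (hμ : μ.Surely s) (hν : ∀ a, s a → (ν a).Surely r) : Surely (bind μ ν) r := by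
  intro p hp
  rw [CostLaw.bind, PMF.mem_support_bind_iff] at hp
  obtain ⟨q, hq, hp⟩ := hp
  rw [PMF.mem_support_map_iff] at hp
  obtain ⟨q', hq', rfl⟩ := hp
  exact hν q.1 (hμ q hq) q' hq'

theorem surely_true (μ : CostLaw α) : μ.Surely fun _ => True := fun _ _ => trivial

theorem Surely.mapList {ν : ι → CostLaw β} {s : β → Prop} (h : ∀ a, (ν a).Surely s) (l : List ι) :
    Surely (mapList ν l) fun bs => bs.length = l.length ∧ ∀ b ∈ bs, s b := by
  induction l with
  | nil => exact Surely.pure (by simp)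
  | cons a l ih =>
    refine (h a).bind fun b hb => ih.bind fun bs hbs => Surely.pure ?_
    simp only [List.length_cons, hbs.1, List.mem_cons, forall_eq_or_imp, true_and]
    exact ⟨hb, hbs.2⟩

theorem Surely.value_mono {μ : CostLaw α} {s : α → Prop} (hμ : μ.Surely s) {f g : α → ℝ≥0∞}
    (h : ∀ a, s a → f a ≤ g a) : μ.value f ≤ μ.value g :=
  PMF.expect_mono_support _ fun p hp => h p.1 (hμ p hp)

theorem Surely.value_congr {μ : CostLaw α} {s : α → Prop} (hμ : μ.Surely s) {f g : α → ℝ≥0∞}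
    (h : ∀ a, s a → f a = g a) : μ.value f = μ.value g :=
  PMF.expect_congr_support _ fun p hp => h p.1 (hμ p hp)

/-- **Chebyshev's inequality**, in terms of an upper bound on the second moment. -/
theorem chebyshev (μ : CostLaw α) (f : α → ℝ) (hf : ∀ a, 0 ≤ f a) {e s δ : ℝ} (he : 0 ≤ e)
    (hs : 0 ≤ s) (hδ : 0 < δ) (h1 : μ.value (fun a => ENNReal.ofReal (f a)) = ENNReal.ofReal e)
    (h2 : μ.value (fun a => ENNReal.ofReal (f a ^ 2)) ≤ ENNReal.ofReal s) :
    μ.value (fun a => if δ ≤ |f a - e| then 1 else 0) ≤ ENNReal.ofReal ((s - e ^ 2) / δ ^ 2) := by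
  -- The identity (f - e)² + 2ef = f² + e² keeps all terms nonnegative, so that expectations can be
  -- taken in `ℝ≥0∞` before anything is subtracted.
  have key : μ.value (fun a => ENNReal.ofReal ((f a - e) ^ 2)) + ENNReal.ofReal (2 * e * e)
      ≤ ENNReal.ofReal (s + e ^ 2) := by
    have : ∀ a, ENNReal.ofReal ((f a - e) ^ 2) + ENNReal.ofReal (2 * e) * ENNReal.ofReal (f a)
        = ENNReal.ofReal (f a ^ 2) + ENNReal.ofReal (e ^ 2) := by
      intro a
      rw [← ENNReal.ofReal_mul (by positivity), ← ENNReal.ofReal_add (by positivity)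
        (mul_nonneg (by positivity) (hf a)), ← ENNReal.ofReal_add (by positivity) (by positivity)]
      congr 1
      ring
    have h3 := congrArg μ.value (funext this)
    rw [value_add, value_add, value_const_mul, h1, value_const,
      ← ENNReal.ofReal_mul (by positivity)] at h3
    rw [h3, ENNReal.ofReal_add hs (by positivity)]
    gcongr
  have hvar : μ.value (fun a => ENNReal.ofReal ((f a - e) ^ 2)) ≤ ENNReal.ofReal (s - e ^ 2) := by
    have h4 := ENNReal.le_sub_of_add_le_right ENNReal.ofReal_ne_top key
    rw [← ENNReal.ofReal_sub _ (by positivity)] at h4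
    refine h4.trans (ENNReal.ofReal_le_ofReal (le_of_eq (by ring)))
  have hM := μ.value_indicator_le (fun a => δ ≤ |f a - e|)
    (fun a => ENNReal.ofReal ((f a - e) ^ 2)) (ENNReal.ofReal (δ ^ 2)) (by
      intro a ha
      apply ENNReal.ofReal_le_ofReal
      rw [← sq_abs (f a - e)]
      gcongr)
  rw [ENNReal.ofReal_div_of_pos (by positivity), ENNReal.le_div_iff_mul_le
    (Or.inl (by simpa using hδ.ne')) (Or.inl ENNReal.ofReal_ne_top)]
  exact hM.trans hvar

/-- The second moment of a sum of independent and identically distributed variables. -/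
theorem value_sum_sq (ν : CostLaw ℝ) (f : ℝ → ℝ) (hf : ∀ a, 0 ≤ f a) (l : List ι) :
    (mapList (fun _ => ν) l).value (fun bs => ENNReal.ofReal ((bs.map f).sum ^ 2)) =
      l.length * ν.value (fun a => ENNReal.ofReal (f a ^ 2)) +
        (l.length * (l.length - 1 : ℕ) : ℕ) * ν.value (fun a => ENNReal.ofReal (f a)) ^ 2 := by
  have hnn : ∀ bs : List ℝ, 0 ≤ (bs.map f).sum := fun bs =>
    List.sum_nonneg (by simpa using fun a _ => hf a)
  have hsum : ∀ l : List ι, (mapList (fun _ => ν) l).value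
      (fun bs => ENNReal.ofReal (bs.map f).sum)
      = l.length * ν.value (fun a => ENNReal.ofReal (f a)) := by
    intro l
    induction l with
    | nil => simp [mapList, value_pure]
    | cons a l ih =>
      simp only [value_mapList_cons, List.map_cons, List.sum_cons, List.length_cons,
        ENNReal.ofReal_add (hf _) (hnn _), value_add, value_const, ih]
      push_cast
      ring
  induction l with
  | nil => simp [mapList, value_pure]
  | cons a l ih =>
    have : ∀ (b : ℝ) (bs : List ℝ), ENNReal.ofReal ((f b + (bs.map f).sum) ^ 2) =
        (ENNReal.ofReal (f b ^ 2) + 2 * ENNReal.ofReal (f b) * ENNReal.ofReal (bs.map f).sum)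
          + ENNReal.ofReal ((bs.map f).sum ^ 2) := by
      intro b bs
      have h1 := hf b
      have h2 := hnn bs
      rw [← ENNReal.ofReal_ofNat, ← ENNReal.ofReal_mul (by norm_num),
        ← ENNReal.ofReal_mul (by positivity), ← ENNReal.ofReal_add (by positivity) (by positivity),
        ← ENNReal.ofReal_add (by positivity) (by positivity)]
      congr 1
      ring
    simp only [value_mapList_cons, List.map_cons, List.sum_cons, List.length_cons, this,
      value_add, value_const, value_const_mul, value_mul_const, ih, hsum]
    rcases l.length with _ | k
    · simp
    · simp only [Nat.add_sub_cancel]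
      push_cast
      ring

/-- The mean of independent variables with values in `[0,1]` is concentrated at its expectation. -/
theorem value_mean_deviation_le {ν : CostLaw ℝ} (hν : ν.Surely fun x => 0 ≤ x ∧ x ≤ 1) {e δ : ℝ}
    (he : 0 ≤ e) (h1 : ν.value ENNReal.ofReal = ENNReal.ofReal e) (hδ : 0 < δ) (l : List ι)
    (hl : l ≠ []) :
    (mapList (fun _ => ν) l).value (fun bs => if δ ≤ |bs.sum / l.length - e| then 1 else 0) ≤
      ENNReal.ofReal (1 / (4 * l.length * δ ^ 2)) := by
  have hm : (0 : ℝ) < l.length := by exact_mod_cast List.length_pos_of_ne_nil hl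
  have hsure := Surely.mapList (ν := fun _ : ι => ν) (fun _ => hν) l
  -- `chebyshev` and `value_sum_sq` want functions that are nonnegative everywhere; `max 0` provides
  -- this and changes nothing almost surely.
  have hmap : ∀ bs : List ℝ, (∀ b ∈ bs, 0 ≤ b ∧ b ≤ 1) → bs.map (max 0) = bs := by
    intro bs hbs
    conv_rhs => rw [← List.map_id bs]
    exact List.map_congr_left fun b hb => max_eq_right (hbs b hb).1
  have hnn : ∀ bs : List ℝ, 0 ≤ (bs.map (max 0)).sum := fun bs =>
    List.sum_nonneg (by simp)
  have hf1 : ν.value (fun a => ENNReal.ofReal (max 0 a)) = ENNReal.ofReal e := by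
    rw [← h1]
    exact hν.value_congr fun a ha => by rw [max_eq_right ha.1]
  -- On [0,1] one has x² ≤ x, so the mean also bounds the second moment, and the variance is at most
  -- e - e² ≤ 1/4.
  have hf2 : ν.value (fun a => ENNReal.ofReal (max 0 a ^ 2)) ≤ ENNReal.ofReal e := by
    rw [← h1]
    refine hν.value_mono fun a ha => ENNReal.ofReal_le_ofReal ?_
    rw [max_eq_right ha.1]
    nlinarith [ha.1, ha.2]
  have hmean : (mapList (fun _ => ν) l).value
      (fun bs => ENNReal.ofReal (bs.map (max 0)).sum) = ENNReal.ofReal (l.length * e) := by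
    have h2 : ∀ bs : List ℝ, ENNReal.ofReal (bs.map (max 0)).sum =
        (bs.map fun b => ENNReal.ofReal (max 0 b)).sum := by
      intro bs
      induction bs with
      | nil => simp
      | cons b bs ih =>
        rw [List.map_cons, List.sum_cons, ENNReal.ofReal_add (le_max_left _ _) (hnn _), ih,
          List.map_cons, List.sum_cons]
    simp only [h2]
    rw [value_mapList_sum, hf1, List.map_const', List.sum_replicate, nsmul_eq_mul,
      ENNReal.ofReal_mul hm.le, ENNReal.ofReal_natCast]
  have hlen : ((l.length - 1 : ℕ) : ℝ) = l.length - 1 := by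
    rw [Nat.cast_sub (List.length_pos_of_ne_nil hl), Nat.cast_one]
  have hsq : (mapList (fun _ => ν) l).value
      (fun bs => ENNReal.ofReal ((bs.map (max 0)).sum ^ 2)) ≤
      ENNReal.ofReal (l.length * e + l.length * (l.length - 1) * e ^ 2) := by
    rw [value_sum_sq ν (max 0) (fun a => le_max_left _ _) l, hf1, ← hlen,
      ENNReal.ofReal_add (by positivity) (by positivity), ENNReal.ofReal_mul hm.le,
      ENNReal.ofReal_mul (by positivity), ENNReal.ofReal_pow he, ENNReal.ofReal_natCast,
      ← Nat.cast_mul, ENNReal.ofReal_natCast]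
    gcongr
  have hcheb := chebyshev (mapList (fun _ : ι => ν) l) (fun bs => (bs.map (max 0)).sum) hnn
    (e := l.length * e) (δ := l.length * δ) (by positivity)
    (by rw [← hlen]; positivity) (by positivity) hmean hsq
  refine le_trans (le_trans (hsure.value_mono fun bs hbs => ?_) hcheb)
    (ENNReal.ofReal_le_ofReal ?_)
  · rw [hmap bs hbs.2]
    have : bs.sum - l.length * e = l.length * (bs.sum / l.length - e) := by
      field_simp
    rw [this, abs_mul, abs_of_pos hm]
    have h3 : δ ≤ |bs.sum / l.length - e| ↔ l.length * δ ≤ l.length * |bs.sum / l.length - e| :=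
      (mul_le_mul_iff_right₀ hm).symm
    simp only [h3, le_refl]
  · rw [div_le_div_iff₀ (by positivity) (by positivity)]
    have : l.length * e + l.length * (l.length - 1) * e ^ 2 - (l.length * e) ^ 2 =
        l.length * (e - e ^ 2) := by ring
    rw [this]
    have h4 : 4 * (e - e ^ 2) ≤ 1 := by nlinarith [sq_nonneg (2 * e - 1)]
    calc l.length * (e - e ^ 2) * (4 * l.length * δ ^ 2)
        = (4 * (e - e ^ 2)) * (l.length * δ) ^ 2 := by ring
      _ ≤ 1 * (l.length * δ) ^ 2 := by gcongr

end CostLaw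

/-! ### Laws of budgeted computations -/

namespace OracleAlg

variable {n : ℕ} {α β : Type}

theorem run_bind (O : Source → Query n → PMF (Cube n)) (x : OracleAlg n α)
    (f : α → OracleAlg n β) : (x.bind f).run O = (x.run O).bind fun a => (f a).run O := by
  induction x with
  | done a => simp [bind, run]
  | query s ρ next ih => simp [bind, run, ih, PMF.bind_bind]
  | coin p hp next ih => simp [bind, run, ih, PMF.bind_bind]

end OracleAlg

/-- What remains of a result and its cost, if only `b` calls are allowed. -/
def chargeBudget {α : Type} (b : ℕ) (p : α × ℕ) : Option (α × ℕ) :=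
  if p.2 ≤ b then some (p.1, b - p.2) else none

/-- `μ` is the joint law of the result and the number of calls of the computation `c`, if the
number of calls is not limited. -/
def HasLaw {n : ℕ} {α : Type} (O : Source → Query n → PMF (Cube n)) (c : Budgeted n α)
    (μ : CostLaw α) : Prop :=
  ∀ b, OracleAlg.run O (c b) = PMF.map (chargeBudget b) μ

namespace HasLaw

variable {n : ℕ} {α β ι : Type} {O : Source → Query n → PMF (Cube n)}

theorem pure (a : α) : HasLaw O (Pure.pure a) (CostLaw.pure a) := by
  intro b
  rw [CostLaw.pure, PMF.pure_map]
  simp [chargeBudget]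
  rfl

/-- Spending p.2 of b calls leaves b - p.2, so truncating step by step equals truncating the total
cost. The continuation is only examined on the support because sampling from Q's marginals need not
terminate for strings outside the support of Q. -/
theorem bind_of_support {c : Budgeted n α} {μ : CostLaw α} {f : α → Budgeted n β}
    {ν : α → CostLaw β} (hc : HasLaw O c μ) (hf : ∀ p ∈ μ.support, HasLaw O (f p.1) (ν p.1)) :
    HasLaw O (c >>= f) (CostLaw.bind μ ν) := by
  intro b
  have : (c >>= f) b = OracleAlg.bind (c b)
      fun o => match o with
        | some p => f p.1 p.2
        | none => .done none := by
    change OracleAlg.bind (c b) _ = _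
    congr 1
    funext o
    rcases o with _ | p <;> rfl
  rw [this, OracleAlg.run_bind, hc b, PMF.bind_map, CostLaw.bind, PMF.map_bind]
  refine PMF.bind_congr_support _ fun p hp => ?_
  rw [PMF.map_comp]
  by_cases hb : p.2 ≤ b
  · simp only [Function.comp_apply, chargeBudget, hb, if_true, hf p hp (b - p.2)]
    congr 1
    funext q
    simp only [chargeBudget, Function.comp_apply]
    by_cases hq : q.2 ≤ b - p.2
    · rw [if_pos hq, if_pos (by omega), Nat.sub_sub]
    · rw [if_neg hq, if_neg (by omega)]
  · simp only [Function.comp_apply, chargeBudget, hb, if_false, OracleAlg.run]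
    have : (chargeBudget b ∘ fun q : β × ℕ => (q.1, p.2 + q.2)) = Function.const _ none := by
      funext q
      simp only [chargeBudget, Function.comp_apply, Function.const]
      rw [if_neg (by omega)]
    rw [this, PMF.map_const]

theorem bind {c : Budgeted n α} {μ : CostLaw α} {f : α → Budgeted n β}
    {ν : α → CostLaw β} (hc : HasLaw O c μ) (hf : ∀ a, HasLaw O (f a) (ν a)) :
    HasLaw O (c >>= f) (CostLaw.bind μ ν) := hc.bind_of_support fun p _ => hf p.1

theorem mapM' {f : ι → Budgeted n β} {ν : ι → CostLaw β} (h : ∀ a, HasLaw O (f a) (ν a))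
    (l : List ι) : HasLaw O (l.mapM' f) (CostLaw.mapList ν l) := by
  induction l with
  | nil => exact pure []
  | cons a l ih =>
    rw [List.mapM'_cons]
    exact (h a).bind fun b => ih.bind fun bs => pure _

theorem call (draw : OracleAlg n α) :
    HasLaw O (call draw) ((draw.run O).map fun a => (a, 1)) := by
  intro b
  rw [PMF.map_comp]
  cases b with
  | zero =>
    have : (chargeBudget 0 ∘ fun a : α => (a, 1)) = Function.const _ none := by
      funext q
      simp [chargeBudget]
    rw [this, PMF.map_const]
    rfl
  | succ b =>
    change OracleAlg.run O (draw.bind fun a => .done (some (a, b))) = _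
    rw [OracleAlg.run_bind]
    simp only [OracleAlg.run]
    rw [PMF.map]
    congr 1

end HasLaw

/-! ### The negative binomial distribution -/

/-- The binomial series with exponent -k. Writing its coefficients with `multichoose` includes k =
0, where no trial is needed. -/
theorem hasSum_multichoose (k : ℕ) {r : ℝ} (h0 : 0 ≤ r) (h1 : r < 1) :
    HasSum (fun i => (Nat.multichoose k i : ℝ) * r ^ i) (1 / (1 - r) ^ k) := by
  cases k with
  | zero =>
    convert hasSum_single (f := fun i => (Nat.multichoose 0 i : ℝ) * r ^ i) 0 ?_ using 1
    · simp
    · intro i hi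
      obtain ⟨i, rfl⟩ := Nat.exists_eq_succ_of_ne_zero hi
      simp
  | succ k =>
    have h := hasSum_choose_mul_geometric_of_norm_lt_one k (r := r)
      (by rwa [Real.norm_of_nonneg h0])
    have e : (fun i => (Nat.multichoose (k + 1) i : ℝ) * r ^ i) =
        fun i => ((i + k).choose k : ℝ) * r ^ i := by
      funext i
      rw [Nat.multichoose_eq, show k + 1 + i - 1 = i + k by omega, Nat.choose_symm_add]
    rw [e]
    exact h

/-- Weighting by the number of trials i + k turns the coefficients for k into those for k + 1.
Moments of the number of trials thus reduce to the same series with a larger exponent. -/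
theorem mul_multichoose (k i : ℕ) :
    (i + k) * Nat.multichoose k i = k * Nat.multichoose (k + 1) i := by
  rcases k with _ | k
  · rcases i with _ | i <;> simp
  · rw [Nat.multichoose_eq, Nat.multichoose_eq, show k + 1 + i - 1 = i + k by omega,
      show k + 1 + 1 + i - 1 = i + k + 1 by omega, Nat.choose_symm_add,
      show (i + k + 1).choose i = (i + k + 1).choose (k + 1) from
        Nat.choose_symm_add (a := i) (b := k + 1),
      show i + (k + 1) = (i + k) + 1 by omega, Nat.add_one_mul_choose_eq, mul_comm]

/-- The law of the number of failures before the `k`-th success in independent trials with success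
probability `p`. -/
noncomputable def negBin (p : ℝ) (hp : 0 < p ∧ p ≤ 1) (k : ℕ) : PMF ℕ :=
  ⟨fun i => ENNReal.ofReal (Nat.multichoose k i * p ^ k * (1 - p) ^ i), by
    have h0 : 0 ≤ 1 - p := sub_nonneg.2 hp.2
    have h := (hasSum_multichoose k h0 (by linarith [hp.1])).mul_left (p ^ k)
    have hp0 := hp.1
    rw [sub_sub_cancel, mul_one_div_cancel (by positivity)] at h
    rw [ENNReal.summable.hasSum_iff, ← ENNReal.ofReal_tsum_of_nonneg (fun i => by positivity)]
    · rw [tsum_congr fun i => show (Nat.multichoose k i * p ^ k * (1 - p) ^ i : ℝ) =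
        p ^ k * (Nat.multichoose k i * (1 - p) ^ i) by ring, h.tsum_eq, ENNReal.ofReal_one]
    · exact h.summable.congr fun i => by ring⟩

section negBin

variable {p : ℝ} (hp : 0 < p ∧ p ≤ 1)

theorem negBin_apply (k i : ℕ) :
    negBin p hp k i = ENNReal.ofReal (Nat.multichoose k i * p ^ k * (1 - p) ^ i) := rfl

theorem negBin_zero : negBin p hp 0 = PMF.pure 0 := by
  ext i
  rcases i with _ | i <;> simp [negBin_apply]

theorem negBin_succ_apply_succ (k i : ℕ) :
    negBin p hp (k + 1) (i + 1) =
      ENNReal.ofReal p * negBin p hp k (i + 1) +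
        ENNReal.ofReal (1 - p) * negBin p hp (k + 1) i := by
  have h0 : 0 ≤ 1 - p := sub_nonneg.2 hp.2
  have hp0 := hp.1
  simp only [negBin_apply]
  rw [← ENNReal.ofReal_mul hp0.le, ← ENNReal.ofReal_mul h0,
    ← ENNReal.ofReal_add (by positivity) (by positivity), Nat.multichoose_succ_succ]
  congr 1
  push_cast
  ring

/-- The first trial either is a success or adds one failure. -/
theorem expect_negBin_succ (k : ℕ) (f : ℕ → ℝ≥0∞) :
    (negBin p hp (k + 1)).expect f =
      ENNReal.ofReal p * (negBin p hp k).expect f +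
        ENNReal.ofReal (1 - p) * (negBin p hp (k + 1)).expect fun i => f (i + 1) := by
  simp only [PMF.expect]
  rw [tsum_eq_zero_add' ENNReal.summable, tsum_eq_zero_add' (f := fun a => negBin p hp k a * f a)
    ENNReal.summable]
  simp only [negBin_succ_apply_succ, add_mul, ENNReal.tsum_add, mul_add,
    ← ENNReal.tsum_mul_left, mul_assoc]
  rw [← add_assoc]
  congr 2
  rw [← mul_assoc]
  congr 1
  rw [negBin_apply, negBin_apply, ← ENNReal.ofReal_mul hp.1.le]
  congr 1
  simp
  ring

theorem expect_negBin_trials (k : ℕ) :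
    (negBin p hp k).expect (fun i => ENNReal.ofReal ((i + k : ℕ) : ℝ)) = ENNReal.ofReal (k / p) := by
  have h0 : 0 ≤ 1 - p := sub_nonneg.2 hp.2
  have hp0 := hp.1
  have h := (hasSum_multichoose (k + 1) h0 (by linarith [hp.1])).mul_left (k * p ^ k)
  have e : k * p ^ k * (1 / (1 - (1 - p)) ^ (k + 1)) = k / p := by
    rw [sub_sub_cancel]
    rw [pow_succ]
    field_simp
  rw [e] at h
  have e2 : ∀ i, negBin p hp k i * ENNReal.ofReal ((i + k : ℕ) : ℝ) =
      ENNReal.ofReal (k * p ^ k * (Nat.multichoose (k + 1) i * (1 - p) ^ i)) := by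
    intro i
    rw [negBin_apply, ← ENNReal.ofReal_mul (by positivity)]
    congr 1
    have := congrArg (Nat.cast : ℕ → ℝ) (mul_multichoose k i)
    rw [Nat.cast_mul, Nat.cast_mul] at this
    linear_combination p ^ k * (1 - p) ^ i * this
  simp only [PMF.expect, e2]
  rw [← ENNReal.ofReal_tsum_of_nonneg (fun i => by positivity) h.summable, h.tsum_eq]

/-- The square (i + k)² is bounded by (i + k)(i + k + 1), whose mean is exact by applying
`mul_multichoose` twice. -/
theorem expect_negBin_trials_sq_le (k : ℕ) :
    (negBin p hp k).expect (fun i => ENNReal.ofReal (((i + k : ℕ) : ℝ) ^ 2)) ≤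
      ENNReal.ofReal (k * (k + 1) / p ^ 2) := by
  have h0 : 0 ≤ 1 - p := sub_nonneg.2 hp.2
  have hp0 := hp.1
  have h := (hasSum_multichoose (k + 2) h0 (by linarith [hp.1])).mul_left (k * (k + 1) * p ^ k)
  have e : k * (k + 1) * p ^ k * (1 / (1 - (1 - p)) ^ (k + 2)) = k * (k + 1) / p ^ 2 := by
    rw [sub_sub_cancel, pow_add]
    field_simp
  rw [e] at h
  have e2 : ∀ i, negBin p hp k i * ENNReal.ofReal (((i + k : ℕ) : ℝ) ^ 2) ≤
      ENNReal.ofReal (k * (k + 1) * p ^ k * (Nat.multichoose (k + 2) i * (1 - p) ^ i)) := by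
    intro i
    rw [negBin_apply, ← ENNReal.ofReal_mul (by positivity)]
    apply ENNReal.ofReal_le_ofReal
    have h1 := congrArg (Nat.cast : ℕ → ℝ) (mul_multichoose k i)
    have h2 := congrArg (Nat.cast : ℕ → ℝ) (mul_multichoose (k + 1) i)
    push_cast at h1 h2 ⊢
    have h3 : (k * (k + 1) * p ^ k * (Nat.multichoose (k + 2) i * (1 - p) ^ i) : ℝ)
        = Nat.multichoose k i * p ^ k * (1 - p) ^ i * ((i + k) * (i + k + 1)) := by
      linear_combination (-k * p ^ k * (1 - p) ^ i) * h2 - p ^ k * (1 - p) ^ i * (i + k + 1) * h1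
    rw [h3]
    gcongr
    nlinarith [(Nat.cast_nonneg i : (0 : ℝ) ≤ i), (Nat.cast_nonneg k : (0 : ℝ) ≤ k)]
  refine (ENNReal.tsum_le_tsum e2).trans ?_
  rw [← ENNReal.ofReal_tsum_of_nonneg (fun i => by positivity) h.summable, h.tsum_eq]

end negBin

/-! ### The law of the number of trials -/

/-- The law of the number of trials up to the `k`-th success, which is also their cost. If the
success probability is not positive, it is a dummy. -/
noncomputable def trialsLaw (p : ℝ) (k : ℕ) : CostLaw ℕ :=
  if hp : 0 < p ∧ p ≤ 1 then (negBin p hp k).map fun i => (i + k, i + k) else CostLaw.pure 0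

theorem value_trialsLaw {p : ℝ} (hp : 0 < p ∧ p ≤ 1) (k : ℕ) :
    (trialsLaw p k).value (fun x => ENNReal.ofReal (x : ℝ)) = ENNReal.ofReal (k / p) := by
  rw [trialsLaw, dif_pos hp, CostLaw.value, PMF.expect_map, expect_negBin_trials]

theorem value_trialsLaw_sq_le {p : ℝ} (hp : 0 < p ∧ p ≤ 1) (k : ℕ) :
    (trialsLaw p k).value (fun x => ENNReal.ofReal ((x : ℝ) ^ 2)) ≤
      ENNReal.ofReal (k * (k + 1) / p ^ 2) := by
  rw [trialsLaw, dif_pos hp, CostLaw.value, PMF.expect_map]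
  exact expect_negBin_trials_sq_le hp k

theorem cost_trialsLaw {p : ℝ} (hp : 0 < p ∧ p ≤ 1) (k : ℕ) :
    (trialsLaw p k).cost = ENNReal.ofReal (k / p) := by
  rw [trialsLaw, dif_pos hp, CostLaw.cost, PMF.expect_map, ← expect_negBin_trials hp]
  simp only [ENNReal.ofReal_natCast]

/-- Induction on the budget. One draw either lowers the number k - t of missing successes or adds
one failure, which is the recursion `expect_negBin_succ`; both branches use up one call, as does
`chargeBudget`. -/
theorem run_countTrials {n : ℕ} (O : Source → Query n → PMF (Cube n)) (draw : OracleAlg n Bool)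
    (c : Bool) {p : ℝ} (hp : 0 < p ∧ p ≤ 1) (hdraw : draw.run O c = ENNReal.ofReal p) (k b : ℕ) :
    ∀ x t, OracleAlg.run O (countTrials draw c k x t b) =
      (negBin p hp (k - t)).map fun i => chargeBudget b (x + (i + (k - t)), i + (k - t)) := by
  classical
  have hnot : draw.run O (!c) = ENNReal.ofReal (1 - p) := by
    have h1 := PMF.expect_const (draw.run O) 1
    rw [PMF.expect_bool _ c, hdraw, mul_one, mul_one] at h1
    have h2 : ENNReal.ofReal p + ENNReal.ofReal (1 - p) = 1 := by
      rw [← ENNReal.ofReal_add hp.1.le (by linarith [hp.2])]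
      simp
    exact (ENNReal.add_right_inj ENNReal.ofReal_ne_top).1 (h1.trans h2.symm)
  have hdone : ∀ x t b, ¬ t < k → (PMF.pure (some (x, b)) : PMF (Option (ℕ × ℕ))) =
      (negBin p hp (k - t)).map fun i => chargeBudget b (x + (i + (k - t)), i + (k - t)) := by
    intro x t b ht
    rw [Nat.sub_eq_zero_of_le (not_lt.1 ht), negBin_zero, PMF.pure_map]
    simp [chargeBudget]
  induction b with
  | zero =>
    intro x t
    by_cases ht : t < k
    · have h1 : OracleAlg.run O (countTrials draw c k x t 0) = PMF.pure none := by
        simp [countTrials, ht, OptionT.mk, OracleAlg.run]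
      have h2 : (fun i => chargeBudget 0 (x + (i + (k - t)), i + (k - t))) =
          Function.const _ none := by
        funext i
        simp only [chargeBudget, Function.const]
        rw [if_neg (by omega)]
      rw [h1, h2, PMF.map_const]
    · rw [← hdone x t 0 ht]
      simp [countTrials, ht, OptionT.mk, OracleAlg.run]
  | succ b ih =>
    intro x t
    by_cases ht : t < k
    · have h1 : OracleAlg.run O (countTrials draw c k x t (b + 1)) = (draw.run O).bind fun α =>
          OracleAlg.run O (countTrials draw c k (x + 1) (if α = c then t + 1 else t) b) := by
        rw [← OracleAlg.run_bind]
        simp only [countTrials, ht, OptionT.mk, if_true]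
        rfl
      rw [h1]
      apply PMF.ext_expect
      intro f
      obtain ⟨s, hs⟩ : ∃ s, k - t = s + 1 := ⟨k - t - 1, by omega⟩
      rw [PMF.expect_bind, PMF.expect_bool _ c, if_pos rfl, if_neg (by cases c <;> simp), ih, ih,
        hdraw, hnot, PMF.expect_map, PMF.expect_map, PMF.expect_map, show k - (t + 1) = s by omega, hs,
        expect_negBin_succ hp s fun i => f (chargeBudget (b + 1) (x + (i + (s + 1)), i + (s + 1)))]
      -- A trial just made may be counted either in x or among the trials still to come, provided
      -- that the budget is shifted by one as well.
      have e : ∀ i j, chargeBudget b (x + 1 + (i + j), i + j) =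
          chargeBudget (b + 1) (x + (i + (j + 1)), i + (j + 1)) := by
        intro i j
        simp only [chargeBudget]
        by_cases h : i + j ≤ b
        · rw [if_pos h, if_pos (by omega)]
          congr 2
          · omega
          · omega
        · rw [if_neg h, if_neg (by omega)]
      simp only [e]
      congr 5
      funext i
      rw [show i + 1 + (s + 1) = i + (s + 1 + 1) by ring]
    · rw [← hdone x t (b + 1) ht]
      simp [countTrials, ht, OptionT.mk, OracleAlg.run]

theorem HasLaw.countTrials {n : ℕ} {O : Source → Query n → PMF (Cube n)} {draw : OracleAlg n Bool}
    {c : Bool} {p : ℝ} (hp : 0 < p ∧ p ≤ 1) (hdraw : draw.run O c = ENNReal.ofReal p) (k : ℕ) :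
    HasLaw O (countTrials draw c k 0 0) (trialsLaw p k) := by
  intro b
  rw [run_countTrials O draw c hp hdraw, trialsLaw, dif_pos hp, PMF.map_comp]
  simp [Function.comp_def]

/-! ### The number of queries of budgeted computations -/

namespace OracleAlg

variable {n : ℕ} {α β : Type}

/-- In every execution, the number of queries plus the value of `r` at the result is at most `b`. -/
def QueryBound (r : α → ℕ) : OracleAlg n α → ℕ → Prop
  | done a, b => r a ≤ b
  | query _ _ next, b => ∃ b', b = b' + 1 ∧ ∀ w, (next w).QueryBound r b'
  | coin _ _ next, b => ∀ c, (next c).QueryBound r b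

theorem QueryBound.maxQueries_le {r : α → ℕ} {x : OracleAlg n α} {b : ℕ}
    (h : x.QueryBound r b) : x.maxQueries ≤ b := by
  induction x generalizing b with
  | done a => exact Nat.zero_le _
  | query s ρ next ih =>
    obtain ⟨b', rfl, h⟩ := h
    rw [maxQueries, add_comm]
    exact Nat.add_le_add_right (Finset.sup_le fun w _ => ih w (h w)) 1
  | coin p hp next ih => exact Finset.sup_le fun c _ => ih c (h c)

theorem QueryBound.mono {r : α → ℕ} {x : OracleAlg n α} {b c : ℕ}
    (h : x.QueryBound r b) (hbc : b ≤ c) : x.QueryBound r c := by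
  induction x generalizing b c with
  | done a => exact le_trans h hbc
  | query s ρ next ih =>
    obtain ⟨b', rfl, h⟩ := h
    exact ⟨c - 1, by omega, fun w => ih w (h w) (by omega)⟩
  | coin p hp next ih => exact fun d => ih d (h d) hbc

theorem QueryBound.bind {r : α → ℕ} {r' : β → ℕ} {x : OracleAlg n α} {f : α → OracleAlg n β}
    {b : ℕ} (h : x.QueryBound r b) (hf : ∀ a, (f a).QueryBound r' (r a)) :
    (x.bind f).QueryBound r' b := by
  induction x generalizing b with
  | done a => exact (hf a).mono h
  | query s ρ next ih =>
    obtain ⟨b', rfl, h⟩ := h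
    exact ⟨b', rfl, fun w => ih w (h w)⟩
  | coin p hp next ih => exact fun d => ih d (h d)

/-- Algorithms that ask one query. -/
def SingleQuery (x : OracleAlg n α) : Prop := ∀ b, x.QueryBound (fun _ => b) (b + 1)

end OracleAlg

/-- The number of calls still allowed, which is `0` after breaking off. -/
def remainingCalls {α : Type} : Option (α × ℕ) → ℕ
  | none => 0
  | some p => p.2

/-- Computations that make at most as many queries as they use up calls. -/
def Frugal {n : ℕ} {α : Type} (c : Budgeted n α) : Prop :=
  ∀ b, OracleAlg.QueryBound remainingCalls (c b) b

namespace Frugal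

variable {n : ℕ} {α β ι : Type}

theorem pure (a : α) : Frugal (Pure.pure a : Budgeted n α) := fun b => le_refl b

theorem bind {c : Budgeted n α} {f : α → Budgeted n β} (hc : Frugal c) (hf : ∀ a, Frugal (f a)) :
    Frugal (c >>= f) := by
  intro b
  change OracleAlg.QueryBound _ (OracleAlg.bind (c b) _) b
  refine (hc b).bind fun o => ?_
  rcases o with _ | ⟨a, b'⟩
  · exact le_refl 0
  · exact hf a b'

theorem mapM' {f : ι → Budgeted n β} (hf : ∀ a, Frugal (f a)) (l : List ι) :
    Frugal (l.mapM' f) := by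
  induction l with
  | nil => exact pure []
  | cons a l ih =>
    rw [List.mapM'_cons]
    exact (hf a).bind fun b => ih.bind fun bs => pure _

theorem call {draw : OracleAlg n α} (h : draw.SingleQuery) : Frugal (call draw) := by
  intro b
  rcases b with _ | b
  · exact le_refl 0
  · exact (h b).bind fun a => le_refl b

theorem countTrials {draw : OracleAlg n Bool} (h : draw.SingleQuery) (c : Bool) (k x t : ℕ) :
    Frugal (countTrials draw c k x t) := by
  intro b
  induction b generalizing x t with
  | zero =>
    rw [_root_.countTrials]
    split_ifs
    exacts [le_refl 0, le_refl 0]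
  | succ b ih =>
    rw [_root_.countTrials]
    split_ifs
    · exact (h b).bind fun a => ih _ _
    · exact le_refl _

theorem subToEval {draw : Cube n → Fin n → OracleAlg n Bool}
    (h : ∀ σ j, (draw σ j).SingleQuery) (ε : ℝ) (σ : Cube n) : Frugal (subToEval draw ε σ) :=
  (mapM' (fun j => countTrials (h σ j) _ _ _ _) _).bind fun _ => pure _

end Frugal

theorem singleQuery_drawMarginal {n : ℕ} (s : Source) (σ : Cube n) (j : Fin n) :
    (drawMarginal s σ j).SingleQuery := fun b => ⟨b, rfl, fun _ => le_refl b⟩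

theorem singleQuery_drawTamedMarginal {n : ℕ} (θ : ℝ) (s : Source) (σ : Cube n) (j : Fin n) :
    (drawTamedMarginal θ s σ j).SingleQuery := by
  refine fun b => ⟨b, rfl, fun w c => ?_⟩
  cases c
  · exact le_refl b
  · exact fun _ => le_refl b

theorem frugal_estimate (n : ℕ) (γ : ℝ) : Frugal (SubVsSub.estimate n γ) := by
  refine (Frugal.mapM' (fun _ => ?_) _).bind fun _ => Frugal.pure _
  refine (Frugal.call (draw := .query Source.Q (fun _ => none) .done)
    fun b => ⟨b, rfl, fun _ => le_refl b⟩).bind fun σ => ?_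
  refine (Frugal.mapM' (fun _ => ?_) _).bind fun _ => Frugal.pure _
  refine (Frugal.subToEval (fun _ _ => singleQuery_drawTamedMarginal _ _ _ _) _ _).bind fun p => ?_
  exact (Frugal.subToEval (fun _ _ => singleQuery_drawMarginal _ _ _) _ _).bind fun q =>
    Frugal.pure _

/-- What the tester does with the outcome of the estimate. -/
noncomputable def verdictOf (ε₁ ε₂ : ℝ) : Option (ℝ × ℕ) → Verdict
  | none => Verdict.reject
  | some p => if p.1 ≤ (ε₁ + ε₂) / 2 then Verdict.accept else Verdict.reject

theorem subVsSub_eq (n : ℕ) (ε₁ ε₂ : ℝ) :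
    subVsSub n ε₁ ε₂ = OracleAlg.bind
      (SubVsSub.estimate n (SubVsSub.gap ε₁ ε₂)
        ⌊SubVsSub.callBound n (SubVsSub.gap ε₁ ε₂)⌋₊)
      fun o => .done (verdictOf ε₁ ε₂ o) := by
  change OracleAlg.bind _ _ = _
  congr 1
  funext o
  rcases o with _ | p <;> rfl

/-- Every call contains exactly one query and coins are free, so the budget bounds the queries
whatever the oracles answer. -/
theorem maxQueries_subVsSub_le (n : ℕ) (ε₁ ε₂ : ℝ) :
    (subVsSub n ε₁ ε₂).maxQueries ≤ ⌊SubVsSub.callBound n (SubVsSub.gap ε₁ ε₂)⌋₊ := by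
  rw [subVsSub_eq]
  exact ((frugal_estimate n _ _).bind (r' := fun _ => 0) fun o => Nat.zero_le _).maxQueries_le

/-! ### The size of the parameters -/

namespace SubVsSub

theorem two_le_log_twenty : 2 ≤ Real.log 20 := by
  rw [Real.le_log_iff_exp_le (by norm_num), show (2 : ℝ) = 1 + 1 by norm_num, Real.exp_add]
  nlinarith [Real.exp_one_lt_d9, Real.exp_pos 1]

theorem log_twenty_le_three : Real.log 20 ≤ 3 := by
  rw [Real.log_le_iff_le_exp (by norm_num), show (3 : ℝ) = 1 + 1 + 1 by norm_num, Real.exp_add,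
    Real.exp_add]
  have h := Real.exp_one_gt_d9
  have h2 : (2.718 : ℝ) * 2.718 ≤ Real.exp 1 * Real.exp 1 := by gcongr <;> linarith
  have h3 : (2.718 * 2.718 : ℝ) * 2.718 ≤ Real.exp 1 * Real.exp 1 * Real.exp 1 := by
    gcongr
    linarith
  linarith

variable {γ : ℝ}

theorem le_numSamples (hγ : 0 < γ) : 32 / γ ^ 2 ≤ numSamples γ := by
  refine le_trans ?_ (Nat.le_ceil _)
  gcongr
  linarith [two_le_log_twenty]

/-- Here 49 = 2^4 · 3 + 1, where the 1 from rounding up is absorbed by γ⁻² ≥ 1. -/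
theorem numSamples_le (hγ : 0 < γ) (hγ' : γ ≤ 1 / 2) : (numSamples γ : ℝ) ≤ 49 / γ ^ 2 := by
  refine (Nat.ceil_lt_add_one (by have := two_le_log_twenty; positivity)).le.trans ?_
  have h1 : 1 ≤ 1 / γ ^ 2 := by
    rw [le_div_iff₀ (by positivity)]
    nlinarith
  have h2 : 2 ^ 4 * Real.log 20 / γ ^ 2 ≤ 48 / γ ^ 2 := by
    gcongr
    linarith [log_twenty_le_three]
  have : (49 : ℝ) / γ ^ 2 = 48 / γ ^ 2 + 1 / γ ^ 2 := by ring
  linarith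

theorem le_numRepeats (γ : ℝ) : 48 * Real.log (10 * numSamples γ) ≤ numRepeats γ := Nat.le_ceil _

theorem numRepeats_le (γ : ℝ) : (numRepeats γ : ℝ) ≤ 48 * Real.log (10 * numSamples γ) + 1 := by
  refine (Nat.ceil_lt_add_one ?_).le
  have := Real.log_natCast_nonneg (10 * numSamples γ)
  push_cast at this
  linarith

theorem one_le_numRepeats (hγ : 0 < γ) (hγ' : γ ≤ 1 / 2) : 1 ≤ numRepeats γ := by
  have h1 : (1 : ℝ) ≤ 32 / γ ^ 2 := by
    rw [le_div_iff₀ (by positivity)]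
    nlinarith
  have h2 : 0 < Real.log (10 * numSamples γ) :=
    Real.log_pos (by linarith [le_numSamples hγ])
  have : (0 : ℝ) < numRepeats γ := by linarith [le_numRepeats γ]
  exact_mod_cast this

/-- The power γ⁻⁵ is γ⁻³ from `callBound` times γ⁻² from m, while t contributes a single logarithm,
whence the exponent 1. -/
theorem callBound_le {n : ℕ} (hn : 1 ≤ n) {ε₁ ε₂ : ℝ} (h0 : 0 ≤ ε₁) (h12 : ε₁ < ε₂)
    (h2 : ε₂ ≤ 1) :
    callBound n (gap ε₁ ε₂) ≤ 10 ^ 11 * ((n : ℝ) ^ 3 / (ε₂ - ε₁) ^ 5) *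
      Real.log (2 + (n : ℝ) ^ 3 / (ε₂ - ε₁) ^ 5) ^ 1 := by
  set X := (n : ℝ) ^ 3 / (ε₂ - ε₁) ^ 5 with hX
  set γ := gap ε₁ ε₂ with hγdef
  have hd : ε₂ - ε₁ = 2 * γ := by rw [hγdef, gap]; ring
  have hγ : 0 < γ := by linarith
  have hγ' : γ ≤ 1 / 2 := by linarith
  have hn' : (1 : ℝ) ≤ n := by exact_mod_cast hn
  have hXeq : X = (n : ℝ) ^ 3 / (32 * γ ^ 5) := by
    rw [hX, hd]
    ring
  have hn3 : (1 : ℝ) ≤ (n : ℝ) ^ 3 := one_le_pow₀ hn'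
  have hXγ : 1 / γ ^ 2 ≤ 4 * X := by
    rw [hXeq, div_le_iff₀ (by positivity)]
    have : 4 * ((n : ℝ) ^ 3 / (32 * γ ^ 5)) * γ ^ 2 = (n : ℝ) ^ 3 / (8 * γ ^ 3) := by
      field_simp
      norm_num
    rw [this, le_div_iff₀ (by positivity)]
    have : γ ^ 3 ≤ (1 / 2) ^ 3 := by gcongr
    linarith
  have hX1 : 1 ≤ X := by
    have : 4 ≤ 1 / γ ^ 2 := by
      rw [le_div_iff₀ (by positivity)]
      nlinarith
    linarith
  set L := Real.log (2 + X) with hL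
  have hL1 : 1 ≤ L := by
    rw [hL, Real.le_log_iff_exp_le (by linarith)]
    linarith [Real.exp_one_lt_d9]
  have hm := numSamples_le hγ hγ'
  have hm1 : (numSamples γ : ℝ) ≤ 196 * X := by
    have : (49 : ℝ) / γ ^ 2 = 49 * (1 / γ ^ 2) := by ring
    linarith
  have hm0 : (0 : ℝ) < numSamples γ := lt_of_lt_of_le (by positivity) (le_numSamples hγ)
  have hlog : Real.log (10 * numSamples γ) ≤ 9 * L := by
    -- The argument 10m is at most 10 · 196 X; the constant 8 is then absorbed using L ≥ 1.
    have e8 : Real.log 1960 ≤ 8 := by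
      rw [Real.log_le_iff_le_exp (by norm_num)]
      have h := Real.exp_one_gt_d9
      have h3 : (2.7 : ℝ) ^ 8 ≤ Real.exp 1 ^ 8 := by gcongr; linarith
      rw [← Real.exp_nat_mul] at h3
      norm_num at h3 ⊢
      linarith
    calc Real.log (10 * numSamples γ) ≤ Real.log (1960 * (2 + X)) := by
          apply Real.log_le_log (by positivity)
          linarith
      _ = Real.log 1960 + L := by rw [Real.log_mul (by norm_num) (by linarith)]
      _ ≤ 9 * L := by linarith
  -- 433 = 48 · 9 + 1, with the rounding unit bounded by L.
  have ht : (numRepeats γ : ℝ) ≤ 433 * L := by linarith [numRepeats_le γ]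
  have hn23 : (n : ℝ) ^ 2 / γ ^ 2 ≤ (n : ℝ) ^ 3 / γ ^ 3 := by
    gcongr ?_ / ?_
    · exact pow_le_pow_right₀ hn' (by norm_num)
    · exact pow_le_pow_of_le_one hγ.le (by linarith) (by norm_num)
  have e : callBound n γ = (10 * 2 ^ 10 * ((n : ℝ) ^ 3 / γ ^ 3)
      + 10 * 2 ^ 9 * ((n : ℝ) ^ 2 / γ ^ 2)) * (numSamples γ * numRepeats γ) := by
    rw [callBound]
    ring
  have e2 : (15360 * ((n : ℝ) ^ 3 / γ ^ 3)) * (49 / γ ^ 2 * (433 * L)) =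
      15360 * 49 * 433 * 32 * X * L := by
    rw [hXeq]
    field_simp
  -- 15360 = 10 (2^10 + 2^9), as the second term of the bound is dominated by the first.
  calc callBound n γ ≤ (15360 * ((n : ℝ) ^ 3 / γ ^ 3)) * (49 / γ ^ 2 * (433 * L)) := by
        rw [e]
        gcongr
        linarith
    _ = 15360 * 49 * 433 * 32 * X * L := e2
    _ ≤ 10 ^ 11 * X * L := by gcongr; norm_num
    _ = _ := by rw [pow_one]

end SubVsSub

/-! ### The median trick -/

/-- If the median were below a, so would be all entries up to the middle of the sorted list; if it
exceeded b, so would all entries from the middle on. Either way at least half of the list lies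
outside the interval. -/
theorem median_mem_Icc {l : List ℝ} {a b : ℝ}
    (h : 2 * l.countP (fun x => ¬(a ≤ x ∧ x ≤ b)) < l.length) :
    a ≤ median l ∧ median l ≤ b := by
  set s := l.insertionSort (· ≤ ·) with hs
  have hperm : s.Perm l := List.perm_insertionSort _ _
  have hlen : s.length = l.length := hperm.length_eq
  have hsort : s.Pairwise (· ≤ ·) := List.pairwise_insertionSort _ _
  rw [← hperm.countP_eq, ← hlen] at h
  have hi : l.length / 2 < s.length := by omega
  have hmed : median l = s[l.length / 2] := by
    rw [median, ← hs, List.getD_eq_getElem _ _ hi]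
  have hmono : ∀ i j (hi : i < s.length) (hj : j < s.length), i ≤ j → s[i] ≤ s[j] := by
    intro i j hi hj hij
    rcases hij.eq_or_lt with rfl | hij
    · exact le_rfl
    · exact List.pairwise_iff_getElem.1 hsort i j hi hj hij
  rw [hmed]
  constructor
  · by_contra hlt
    have hc : (s.take (l.length / 2 + 1)).countP (fun x => ¬(a ≤ x ∧ x ≤ b)) =
        (s.take (l.length / 2 + 1)).length := by
      rw [List.countP_eq_length]
      intro x hx
      obtain ⟨i, hi', rfl⟩ := List.mem_take_iff_getElem.1 hx
      have := hmono i (l.length / 2) (by omega) hi (by omega)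
      simp only [decide_eq_true_eq, not_and_or]
      exact Or.inl fun h => hlt (h.trans this)
    have h2 := (List.take_sublist (l.length / 2 + 1) s).countP_le
      (p := fun x => decide ¬(a ≤ x ∧ x ≤ b))
    rw [hc, List.length_take] at h2
    omega
  · by_contra hlt
    have hc : (s.drop (l.length / 2)).countP (fun x => ¬(a ≤ x ∧ x ≤ b)) =
        (s.drop (l.length / 2)).length := by
      rw [List.countP_eq_length]
      intro x hx
      obtain ⟨i, hi', rfl⟩ := List.mem_drop_iff_getElem.1 hx
      have := hmono (l.length / 2) (l.length / 2 + i) hi (by omega) (by omega)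
      simp only [decide_eq_true_eq, not_and_or]
      exact Or.inr fun h => hlt (this.trans h)
    have h2 := (List.drop_sublist (l.length / 2) s).countP_le
      (p := fun x => decide ¬(a ≤ x ∧ x ≤ b))
    rw [hc, List.length_drop] at h2
    omega

/-- If each of several independent trials is bad with probability at most `1/3`, then it is unlikely
that half of them are bad. -/
theorem CostLaw.value_half_bad_le {β ι : Type} (ν : CostLaw β) (bad : β → Prop) [DecidablePred bad]
    (h : ν.value (fun b => if bad b then 1 else 0) ≤ ENNReal.ofReal (1 / 3)) (l : List ι) :
    (mapList (fun _ => ν) l).value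
        (fun bs => if l.length ≤ 2 * bs.countP bad then 1 else 0) ≤
      ENNReal.ofReal ((17 / 18) ^ l.length) := by
  -- A bad trial gets weight 9/4 = (3/2)², a good one weight 1. The mean weight is at most 1 +
  -- (5/4)(1/3) = 17/12, and Markov's inequality at level (3/2)^t leaves (17/12)/(3/2) = 17/18 per
  -- trial.
  set g : β → ℝ≥0∞ := fun b => 1 + ENNReal.ofReal (5 / 4) * if bad b then 1 else 0 with hg
  have hgν : ν.value g ≤ ENNReal.ofReal (17 / 12) := by
    rw [hg, value_add, value_const, value_const_mul]
    calc 1 + ENNReal.ofReal (5 / 4) * ν.value (fun b => if bad b then 1 else 0)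
        ≤ ENNReal.ofReal 1 + ENNReal.ofReal (5 / 4) * ENNReal.ofReal (1 / 3) := by
          rw [ENNReal.ofReal_one]
          gcongr
      _ = ENNReal.ofReal (17 / 12) := by
          rw [← ENNReal.ofReal_mul (by norm_num), ← ENNReal.ofReal_add (by norm_num) (by norm_num)]
          norm_num
  have hprod : ∀ bs : List β, (bs.map g).prod = ENNReal.ofReal ((9 / 4) ^ bs.countP bad) := by
    intro bs
    induction bs with
    | nil => simp
    | cons b bs ih =>
      rw [List.map_cons, List.prod_cons, ih, List.countP_cons]
      by_cases hb : bad b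
      · have : g b = ENNReal.ofReal (9 / 4) := by
          rw [hg]
          simp only [hb, if_true, mul_one]
          rw [← ENNReal.ofReal_one, ← ENNReal.ofReal_add (by norm_num) (by norm_num)]
          norm_num
        rw [this, ← ENNReal.ofReal_mul (by norm_num)]
        simp [hb, pow_succ, mul_comm]
      · simp [hg, hb]
  have hM := (mapList (fun _ : ι => ν) l).value_indicator_le
    (fun bs => l.length ≤ 2 * bs.countP bad) (fun bs => (bs.map g).prod)
    (ENNReal.ofReal ((3 / 2) ^ l.length)) (by
      intro bs hbs
      rw [hprod]
      apply ENNReal.ofReal_le_ofReal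
      calc ((3 / 2 : ℝ)) ^ l.length ≤ (3 / 2) ^ (2 * bs.countP bad) :=
            pow_le_pow_right₀ (by norm_num) hbs
        _ = (9 / 4) ^ bs.countP bad := by rw [pow_mul]; norm_num)
  rw [value_mapList_prod, List.map_const', List.prod_replicate] at hM
  have hpos : (0 : ℝ) < (3 / 2) ^ l.length := by positivity
  rw [← ENNReal.le_div_iff_mul_le (Or.inl (by simp))
    (Or.inl ENNReal.ofReal_ne_top)] at hM
  refine hM.trans ?_
  rw [ENNReal.div_le_iff_le_mul (Or.inl (by simp)) (Or.inl ENNReal.ofReal_ne_top),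
    ← ENNReal.ofReal_mul (by positivity), ← mul_pow]
  refine (pow_le_pow_left' hgν _).trans ?_
  rw [← ENNReal.ofReal_pow (by norm_num)]
  apply ENNReal.ofReal_le_ofReal
  norm_num

/-! ### Products of conditional probabilities -/

theorem sum_cube_succ {n : ℕ} {R : Type*} [AddCommMonoid R] (f : Cube (n + 1) → R) :
    ∑ σ, f σ = ∑ b : Bool, ∑ τ : Cube n, f (Fin.cons b τ) := by
  rw [← (Fin.consEquiv fun _ => Bool).sum_comp, Fintype.sum_prod_type]
  rfl

/-- Families of functions of a bit, for each position, that depend on the previous bits only. -/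
def PrefixDependent {n : ℕ} {R : Type*} (K : Fin n → Cube n → Bool → R) : Prop :=
  ∀ j σ τ, (∀ i < j, σ i = τ i) → K j σ = K j τ

theorem PrefixDependent.tail {n : ℕ} {R : Type*} {K : Fin (n + 1) → Cube (n + 1) → Bool → R}
    (h : PrefixDependent K) (b : Bool) :
    PrefixDependent fun (j : Fin n) (σ : Cube n) => K j.succ (Fin.cons b σ) := by
  intro j σ τ hστ
  refine h _ _ _ fun i hi => ?_
  refine Fin.cases (fun _ => rfl) (fun i hi => ?_) i hi
  simpa using hστ i (Fin.succ_lt_succ_iff.1 hi)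

/-- The factor at position 0 depends on no earlier bits, so an arbitrary σ₀ can stand in for the
string. This isolates the first bit for inductions on n. -/
theorem prod_chain_cons {n : ℕ} {R : Type*} [CommMonoid R]
    {K : Fin (n + 1) → Cube (n + 1) → Bool → R} (h : PrefixDependent K) (σ₀ : Cube (n + 1))
    (b : Bool) (τ : Cube n) :
    ∏ j, K j (Fin.cons b τ) ((Fin.cons b τ : Cube (n + 1)) j) =
      K 0 σ₀ b * ∏ j : Fin n, K j.succ (Fin.cons b τ) (τ j) := by
  rw [Fin.prod_univ_succ, h 0 (Fin.cons b τ) σ₀ fun i hi => absurd hi (Fin.not_lt_zero i)]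
  simp

/-- Once the first bit is fixed, the remaining factors form a shorter chain, so the bits can be
summed out recursively. The bound may vary with the position because `expect_inv_condProb_le` needs
2 at one position and 1 at the others. -/
theorem sum_chain_le {n : ℕ} {R : Type*} [CommSemiring R] [PartialOrder R] [IsOrderedRing R]
    {K : Fin n → Cube n → Bool → R} (hK : PrefixDependent K) (h0 : ∀ j σ b, 0 ≤ K j σ b)
    {c : Fin n → R} (hc : ∀ j σ, ∑ b, K j σ b ≤ c j) :
    ∑ σ : Cube n, ∏ j, K j σ (σ j) ≤ ∏ j, c j := by
  induction n with
  | zero => simp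
  | succ n ih =>
    set σ₀ : Cube (n + 1) := fun _ => false
    have hc0 : ∀ j, 0 ≤ c j := fun j =>
      (Finset.sum_nonneg fun b _ => h0 j σ₀ b).trans (hc j σ₀)
    simp only [sum_cube_succ, prod_chain_cons hK σ₀, ← Finset.mul_sum]
    rw [Fin.prod_univ_succ]
    calc _ ≤ ∑ b, K 0 σ₀ b * ∏ j : Fin n, c j.succ := by
          refine Finset.sum_le_sum fun b _ => mul_le_mul_of_nonneg_left ?_ (h0 _ _ _)
          exact ih (hK.tail b) (fun _ _ _ => h0 _ _ _) fun _ _ => hc _ _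
      _ = (∑ b, K 0 σ₀ b) * ∏ j : Fin n, c j.succ := by rw [Finset.sum_mul]
      _ ≤ _ := mul_le_mul_of_nonneg_right (hc 0 σ₀) (Finset.prod_nonneg fun j _ => hc0 _)

/-- The `ℓ¹`-distance of two distributions is at most the sum of the maximal `ℓ¹`-distances of
the conditional distributions of their bits. -/
theorem sum_abs_chain_sub_le {n : ℕ} {K K' : Fin n → Cube n → Bool → ℝ} (hK : PrefixDependent K)
    (hK' : PrefixDependent K') (h0 : ∀ j σ b, 0 ≤ K j σ b) (h0' : ∀ j σ b, 0 ≤ K' j σ b)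
    (h1 : ∀ j σ, ∑ b, K j σ b ≤ 1) (h1' : ∀ j σ, ∑ b, K' j σ b ≤ 1) {d : ℝ} (hd0 : 0 ≤ d)
    (hd : ∀ j σ, ∑ b, |K j σ b - K' j σ b| ≤ d) :
    ∑ σ : Cube n, |∏ j, K j σ (σ j) - ∏ j, K' j σ (σ j)| ≤ n * d := by
  induction n with
  | zero => simp
  | succ n ih =>
    set σ₀ : Cube (n + 1) := fun _ => false
    simp only [sum_cube_succ, prod_chain_cons hK σ₀, prod_chain_cons hK' σ₀]
    -- Hybrid step: ab - a'b' = (a - a')b + a'(b - b'), where the tail b sums to at most 1 and the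
    -- tails differ by at most n·d by induction.
    have key : ∀ b, ∑ τ : Cube n, |K 0 σ₀ b * ∏ j : Fin n, K j.succ (Fin.cons b τ) (τ j) -
        K' 0 σ₀ b * ∏ j : Fin n, K' j.succ (Fin.cons b τ) (τ j)| ≤
        |K 0 σ₀ b - K' 0 σ₀ b| + K' 0 σ₀ b * (n * d) := by
      intro b
      have hs : ∑ τ : Cube n, ∏ j : Fin n, K j.succ (Fin.cons b τ) (τ j) ≤ 1 := by
        simpa using sum_chain_le (hK.tail b) (fun _ _ _ => h0 _ _ _) (c := fun _ => 1)
          fun _ _ => h1 _ _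
      have hi := ih (hK.tail b) (hK'.tail b) (fun _ _ _ => h0 _ _ _) (fun _ _ _ => h0' _ _ _)
        (fun _ _ => h1 _ _) (fun _ _ => h1' _ _) (fun _ _ => hd _ _)
      calc _ ≤ ∑ τ : Cube n, (|K 0 σ₀ b - K' 0 σ₀ b| *
              ∏ j : Fin n, K j.succ (Fin.cons b τ) (τ j) +
            K' 0 σ₀ b * |∏ j : Fin n, K j.succ (Fin.cons b τ) (τ j) -
              ∏ j : Fin n, K' j.succ (Fin.cons b τ) (τ j)|) := by
            refine Finset.sum_le_sum fun τ _ => ?_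
            have hp : 0 ≤ ∏ j : Fin n, K j.succ (Fin.cons b τ) (τ j) :=
              Finset.prod_nonneg fun j _ => h0 _ _ _
            rw [← abs_of_nonneg hp, ← abs_mul, abs_of_nonneg hp]
            nth_rw 3 [← abs_of_nonneg (h0' 0 σ₀ b)]
            rw [← abs_mul]
            refine (le_of_eq (congrArg _ ?_)).trans (abs_add_le _ _)
            ring
        _ ≤ |K 0 σ₀ b - K' 0 σ₀ b| * 1 + K' 0 σ₀ b * (n * d) := by
            rw [Finset.sum_add_distrib, ← Finset.mul_sum, ← Finset.mul_sum]
            gcongr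
            exact h0' _ _ _
        _ = _ := by rw [mul_one]
    refine (Finset.sum_le_sum fun b _ => key b).trans ?_
    rw [Finset.sum_add_distrib, ← Finset.sum_mul]
    have := hd 0 σ₀
    have := mul_le_mul_of_nonneg_right (h1' 0 σ₀) (by positivity : 0 ≤ n * d)
    push_cast
    linarith

/-! ### The conditional probabilities that an oracle gives access to -/

/-- The probability that the `j`-th bit of the answer to `σ[1] ⋯ σ[j-1] * ⋯ *` is `b`. -/
noncomputable def condProb {n : ℕ} (A : Query n → PMF (Cube n)) (j : Fin n) (σ : Cube n)
    (b : Bool) : ℝ :=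
  ((A (prefixQuery σ j)).map (fun w => w j) b).toReal

section condProb

variable {n : ℕ} (A : Query n → PMF (Cube n))

theorem prefixDependent_condProb : PrefixDependent (condProb A) := by
  intro j σ τ h
  have : prefixQuery σ j = prefixQuery τ j := by
    funext i
    simp only [prefixQuery]
    split_ifs with hi
    · rw [h i hi]
    · rfl
  funext b
  rw [condProb, condProb, this]

theorem condProb_nonneg (j : Fin n) (σ : Cube n) (b : Bool) : 0 ≤ condProb A j σ b :=
  ENNReal.toReal_nonneg

theorem sum_condProb (j : Fin n) (σ : Cube n) : ∑ b, condProb A j σ b = 1 := by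
  simp only [condProb]
  have h := PMF.tsum_coe ((A (prefixQuery σ j)).map fun w => w j)
  rw [tsum_fintype] at h
  rw [← ENNReal.toReal_sum fun b _ => PMF.apply_ne_top _ _, h, ENNReal.toReal_one]

theorem condProb_le_one (j : Fin n) (σ : Cube n) (b : Bool) : condProb A j σ b ≤ 1 := by
  rw [← sum_condProb A j σ]
  exact Finset.single_le_sum (fun c _ => condProb_nonneg A j σ c) (Finset.mem_univ b)

theorem ofReal_condProb (j : Fin n) (σ : Cube n) (b : Bool) :
    ENNReal.ofReal (condProb A j σ b) = (A (prefixQuery σ j)).map (fun w => w j) b :=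
  ENNReal.ofReal_toReal (PMF.apply_ne_top _ _)

variable {A}

/-- The chain rule. -/
theorem prod_condProb {D : PMF (Cube n)} (hA : IsSubcondOracle D A) (σ : Cube n) :
    ∏ j, condProb A j σ (σ j) = (D σ).toReal := by
  classical
  -- The probability under D of agreeing with σ in the first k bits. Its successive ratios are the
  -- conditional probabilities, and the product telescopes to D(σ).
  set agree : ℕ → ℝ≥0∞ := fun k => D.expect fun w => if ∀ i : Fin n, i < k → w i = σ i then 1 else 0
    with hagree
  have hstep : ∀ j : Fin n, agree (j + 1) =
      agree j * (A (prefixQuery σ j)).map (fun w => w j) (σ j) := by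
    intro j
    have hmem : ∀ w, w ∈ subcube (prefixQuery σ j) ↔ ∀ i : Fin n, i < (j : ℕ) → w i = σ i := by
      intro w
      simp only [subcube, prefixQuery, Set.mem_ofPred_eq]
      constructor
      · intro h i hi
        exact h i (σ i) (if_pos hi)
      · intro h i b hb
        split_ifs at hb with hi
        rw [h i hi]
        exact Option.some.inj hb
    have hsucc : ∀ w : Cube n, (∀ i : Fin n, (i : ℕ) < j + 1 → w i = σ i) ↔
        (∀ i : Fin n, i < (j : ℕ) → w i = σ i) ∧ w j = σ j := by
      intro w
      constructor
      · intro h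
        exact ⟨fun i hi => h i (by omega), h j (by omega)⟩
      · rintro ⟨h, hj⟩ i hi
        rcases Nat.lt_succ_iff_lt_or_eq.1 hi with hi | hi
        · exact h i hi
        · rw [Fin.ext hi, hj]
    by_cases hex : ∃ w ∈ subcube (prefixQuery σ j), w ∈ D.support
    · have htot : agree j = ∑' w, (subcube (prefixQuery σ j)).indicator D w := by
        simp only [hagree, PMF.expect]
        refine tsum_congr fun w => ?_
        by_cases hw : w ∈ subcube (prefixQuery σ j)
        · rw [Set.indicator_of_mem hw, if_pos ((hmem w).1 hw), mul_one]
        · rw [Set.indicator_of_notMem hw, if_neg (mt (hmem w).2 hw), mul_zero]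
      have hne : agree j ≠ 0 := by
        obtain ⟨w, hw, hwD⟩ := hex
        rw [htot, Ne, ENNReal.tsum_eq_zero, not_forall]
        exact ⟨w, by rwa [Set.indicator_of_mem hw]⟩
      have hnt : agree j ≠ ⊤ := by
        refine ne_top_of_le_ne_top ENNReal.one_ne_top ?_
        rw [← PMF.expect_const D 1]
        exact PMF.expect_mono _ fun w => by split_ifs <;> simp
      rw [hA _ hex, PMF.apply_eq_expect, PMF.expect_map, PMF.expect]
      simp only [PMF.filter_apply, ← htot]
      rw [← ENNReal.tsum_mul_left, hagree]
      refine tsum_congr fun w => ?_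
      by_cases hw : w ∈ subcube (prefixQuery σ j)
      · rw [Set.indicator_of_mem hw]
        have hw' : (∀ i : Fin n, (i : ℕ) < j + 1 → w i = σ i) ↔ w j = σ j := by
          rw [hsucc, and_iff_right ((hmem w).1 hw)]
        simp only [hw']
        rw [mul_comm (D w) (agree j)⁻¹, ← mul_assoc, ← mul_assoc, ENNReal.mul_inv_cancel hne hnt,
          one_mul]
      · rw [Set.indicator_of_notMem hw, zero_mul, zero_mul, mul_zero]
        have hw' : ¬ ∀ i : Fin n, (i : ℕ) < j + 1 → w i = σ i :=
          fun h => hw ((hmem w).2 ((hsucc w).1 h).1)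
        simp only [hw', if_false, mul_zero]
    -- If the prefix is a null event, the oracle may answer arbitrarily, but the identity then reads
    -- 0 = 0.
    · have hz : ∀ w, (∀ i : Fin n, i < (j : ℕ) → w i = σ i) → D w = 0 := by
        intro w hw
        by_contra h0
        exact hex ⟨w, (hmem w).2 hw, h0⟩
      have h1 : agree j = 0 := by
        simp only [hagree, PMF.expect, ENNReal.tsum_eq_zero]
        intro w
        split_ifs with h
        · simp [hz w h]
        · simp
      have h2 : agree (j + 1) = 0 := by
        simp only [hagree, PMF.expect, ENNReal.tsum_eq_zero]
        intro w
        split_ifs with h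
        · simp [hz w ((hsucc w).1 h).1]
        · simp
      rw [h1, h2, zero_mul]
  have hprod : ∀ k ≤ n, agree k = ∏ j ∈ Finset.range k,
      if h : j < n then (A (prefixQuery σ ⟨j, h⟩)).map (fun w => w ⟨j, h⟩) (σ ⟨j, h⟩) else 1 := by
    intro k hk
    induction k with
    | zero =>
      simp only [hagree, Finset.range_zero, Finset.prod_empty]
      simpa using PMF.expect_const D 1
    | succ k ih =>
      rw [Finset.prod_range_succ, ← ih (by omega), dif_pos (by omega)]
      exact hstep ⟨k, by omega⟩
  have hlast : agree n = D σ := by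
    rw [PMF.apply_eq_expect]
    simp only [hagree, Fin.is_lt, true_imp_iff, funext_iff]
  have := hprod n le_rfl
  rw [hlast, Finset.prod_range] at this
  simp only [Fin.is_lt, dif_pos, Fin.eta] at this
  rw [this, ENNReal.toReal_prod]
  rfl

end condProb

/-! ### The law of the estimates of probabilities -/

theorem ofReal_list_prod {α : Type*} (f : α → ℝ) (hf : ∀ a, 0 ≤ f a) (l : List α) :
    ENNReal.ofReal (l.map f).prod = (l.map fun a => ENNReal.ofReal (f a)).prod := by
  induction l with
  | nil => simp
  | cons a l ih =>
    rw [List.map_cons, List.prod_cons, ENNReal.ofReal_mul (hf a), ih, List.map_cons,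
      List.prod_cons]

/-- The law of the result and the cost of `subToEval`, if `q j` is the probability of seeing the
`j`-th bit of the given string. -/
noncomputable def subToEvalLaw {n : ℕ} (q : Fin n → ℝ) (k : ℕ) : CostLaw ℝ :=
  CostLaw.bind (CostLaw.mapList (fun j => trialsLaw (q j) k) (List.finRange n)) fun (xs : List ℕ) =>
    CostLaw.pure (xs.map fun x : ℕ => (k : ℝ) / (x : ℝ)).prod

theorem HasLaw.subToEval {n : ℕ} {O : Source → Query n → PMF (Cube n)}
    {draw : Cube n → Fin n → OracleAlg n Bool} {σ : Cube n} {q : Fin n → ℝ}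
    (hq : ∀ j, 0 < q j ∧ q j ≤ 1) (hdraw : ∀ j, (draw σ j).run O (σ j) = ENNReal.ofReal (q j))
    (ε : ℝ) : HasLaw O (subToEval draw ε σ) (subToEvalLaw q ⌈4 * (n : ℝ) / ε ^ 2⌉₊) :=
 by
  refine (HasLaw.mapM' (fun j => HasLaw.countTrials (hq j) (hdraw j) _) _).bind fun xs => ?_
  convert HasLaw.pure _ using 2
  simp [List.map_eq_flatMap, List.flatMap_assoc]

section subToEvalLaw

variable {n : ℕ} {q : Fin n → ℝ}

theorem surely_subToEvalLaw (q : Fin n → ℝ) (k : ℕ) : (subToEvalLaw q k).Surely fun e => 0 ≤ e := by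
  refine (CostLaw.surely_true _).bind fun xs _ => CostLaw.Surely.pure ?_
  refine List.prod_nonneg fun x hx => ?_
  obtain ⟨y, _, rfl⟩ := List.mem_map.1 hx
  positivity

theorem cost_subToEvalLaw (hq : ∀ j, 0 < q j ∧ q j ≤ 1) (k : ℕ) :
    (subToEvalLaw q k).cost = ∑ j, ENNReal.ofReal (k / q j) := by
  simp only [subToEvalLaw, CostLaw.cost_bind, CostLaw.cost_pure, CostLaw.value_const, add_zero,
    CostLaw.cost_mapList]
  rw [Fin.sum_univ_def]
  simp only [fun j => cost_trialsLaw (hq j) k]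

/-- `e` agrees with `D` up to a factor of about `1 ± ε`. -/
def IsClose (ε D e : ℝ) : Prop := D / (1 + ε) ≤ e ∧ e ≤ D / (1 - ε)

-- The reciprocal of the estimate is a product of independent variables x_j/k with means 1/q_j, so
-- it is unbiased for 1/D and Chebyshev's inequality applies to it. Inverting the interval (1 ± ε)/D
-- accounts for the denominators in `IsClose`.
open Classical in
theorem value_not_isClose_le (hq : ∀ j, 0 < q j ∧ q j ≤ 1) {k : ℕ} (hk : 0 < k) {ε : ℝ}
    (hε : 0 < ε) (hε1 : ε < 1) :
    (subToEvalLaw q k).value (fun e => if ¬ IsClose ε (∏ j, q j) e then 1 else 0) ≤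
      ENNReal.ofReal (((1 + 1 / k) ^ n - 1) / ε ^ 2) := by
  have hk' : (0 : ℝ) < k := by exact_mod_cast hk
  set D := ∏ j, q j with hD
  have hDpos : 0 < D := Finset.prod_pos fun j _ => (hq j).1
  set f : List ℕ → ℝ := fun xs => (xs.map fun x : ℕ => (x : ℝ) / k).prod with hf
  have hnn : ∀ xs, 0 ≤ f xs := by
    intro xs
    refine List.prod_nonneg fun x hx => ?_
    obtain ⟨y, _, rfl⟩ := List.mem_map.1 hx
    positivity
  have hinv : ∀ xs : List ℕ, (xs.map fun x : ℕ => (k : ℝ) / x).prod = (f xs)⁻¹ := by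
    intro xs
    induction xs with
    | nil => simp [hf]
    | cons x xs ih =>
      simp only [hf] at ih ⊢
      rw [List.map_cons, List.prod_cons, ih, List.map_cons, List.prod_cons, mul_inv, inv_div]
  set μ := CostLaw.mapList (fun j => trialsLaw (q j) k) (List.finRange n) with hμ
  have h1 : μ.value (fun xs => ENNReal.ofReal (f xs)) = ENNReal.ofReal (1 / D) := by
    simp only [hf, ofReal_list_prod (fun x : ℕ => (x : ℝ) / k) fun x => by positivity]
    rw [hμ, CostLaw.value_mapList_prod, ← Fin.prod_univ_def, one_div, hD, ← Finset.prod_inv_distrib,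
      ENNReal.ofReal_prod_of_nonneg fun j _ => (inv_pos.2 (hq j).1).le]
    refine Finset.prod_congr rfl fun j _ => ?_
    simp only [div_eq_mul_inv, ENNReal.ofReal_mul (Nat.cast_nonneg _)]
    rw [CostLaw.value_mul_const, value_trialsLaw (hq j), ← ENNReal.ofReal_mul
      (div_nonneg hk'.le (hq j).1.le)]
    congr 1
    field_simp
  have h2 : μ.value (fun xs => ENNReal.ofReal (f xs ^ 2)) ≤
      ENNReal.ofReal ((1 + 1 / k) ^ n / D ^ 2) := by
    have hfsq : ∀ xs, f xs ^ 2 = (xs.map fun x : ℕ => ((x : ℝ) / k) ^ 2).prod := by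
      intro xs
      induction xs with
      | nil => simp [hf]
      | cons x xs ih =>
        simp only [hf] at ih ⊢
        rw [List.map_cons, List.prod_cons, mul_pow, ih, List.map_cons, List.prod_cons]
    simp only [hfsq, ofReal_list_prod (fun x : ℕ => ((x : ℝ) / k) ^ 2) fun x => by positivity]
    have : (1 + 1 / k : ℝ) ^ n / D ^ 2 = ∏ j : Fin n, (1 + 1 / k : ℝ) / q j ^ 2 := by
      rw [Finset.prod_div_distrib, Finset.prod_const, Finset.card_univ, Fintype.card_fin, hD,
        Finset.prod_pow]
    rw [this, hμ, CostLaw.value_mapList_prod, ← Fin.prod_univ_def,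
      ENNReal.ofReal_prod_of_nonneg fun j _ => by positivity]
    refine Finset.prod_le_prod' fun j _ => ?_
    simp only [div_pow, div_eq_mul_inv (_ ^ 2) ((k : ℝ) ^ 2),
      fun x : ℕ => ENNReal.ofReal_mul (q := ((k : ℝ) ^ 2)⁻¹) (by positivity : 0 ≤ (x : ℝ) ^ 2)]
    rw [CostLaw.value_mul_const]
    refine (mul_le_mul_left (value_trialsLaw_sq_le (hq j) k) _).trans ?_
    rw [← ENNReal.ofReal_mul (by positivity)]
    apply ENNReal.ofReal_le_ofReal
    have := (hq j).1
    apply le_of_eq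
    field_simp
  have hc := CostLaw.chebyshev μ f hnn (e := 1 / D) (δ := ε / D) (by positivity) (by positivity)
    (by positivity) h1 h2
  have e1 : ((1 + 1 / k : ℝ) ^ n / D ^ 2 - (1 / D) ^ 2) / (ε / D) ^ 2 =
      ((1 + 1 / k) ^ n - 1) / ε ^ 2 := by
    field_simp
  rw [e1] at hc
  refine le_trans ?_ hc
  rw [subToEvalLaw, CostLaw.value_bind]
  refine CostLaw.value_mono _ fun xs => ?_
  rw [CostLaw.value_pure, hinv]
  by_cases h : ε / D ≤ |f xs - 1 / D|
  · rw [if_pos h]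
    split_ifs <;> simp
  · rw [if_neg h, if_neg]
    rw [not_not]
    rw [not_le, abs_lt] at h
    have hl : (1 - ε) / D ≤ f xs := by
      rw [sub_div]
      linarith
    have hr : f xs ≤ (1 + ε) / D := by
      rw [add_div]
      linarith
    have hpos : 0 < (1 - ε) / D := div_pos (by linarith) hDpos
    constructor
    · rw [← inv_div]
      exact inv_anti₀ (hpos.trans_le hl) hr
    · rw [← inv_div]
      exact inv_anti₀ hpos hl

open Classical in
theorem value_not_isClose_le_third (hn : 1 ≤ n) (hq : ∀ j, 0 < q j ∧ q j ≤ 1) {ε : ℝ} (hε : 0 < ε)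
    (hε1 : ε ≤ 1 / 2) :
    (subToEvalLaw q ⌈4 * (n : ℝ) / ε ^ 2⌉₊).value
      (fun e => if ¬ IsClose ε (∏ j, q j) e then 1 else 0) ≤ ENNReal.ofReal (1 / 3) := by
  have hn' : (1 : ℝ) ≤ n := by exact_mod_cast hn
  set k := ⌈4 * (n : ℝ) / ε ^ 2⌉₊ with hk
  have hkpos : 0 < k := Nat.ceil_pos.2 (by positivity)
  have hkle : 4 * (n : ℝ) / ε ^ 2 ≤ k := Nat.le_ceil _
  have hk' : (0 : ℝ) < k := by exact_mod_cast hkpos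
  refine (value_not_isClose_le hq hkpos hε (by linarith)).trans (ENNReal.ofReal_le_ofReal ?_)
  rw [div_le_iff₀ (by positivity)] at hkle ⊢
  have hu : (n : ℝ) / k ≤ ε ^ 2 / 4 := by
    rw [div_le_div_iff₀ hk' (by norm_num)]
    linarith
  have hε2 : ε ^ 2 ≤ (1 / 2) ^ 2 := by gcongr
  -- With u = n/k ≤ ε²/4, the chain (1 + 1/k)^n ≤ e^u ≤ 1/(1 - u) bounds the relative variance by
  -- ε²/3.
  have hexp : (1 + 1 / k : ℝ) ^ n ≤ 1 / (1 - n / k) := by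
    calc (1 + 1 / k : ℝ) ^ n ≤ Real.exp (1 / k) ^ n := by
          gcongr
          linarith [Real.add_one_le_exp (1 / k : ℝ)]
      _ = Real.exp (n / k) := by
          rw [← Real.exp_nat_mul]
          congr 1
          ring
      _ ≤ _ := Real.exp_bound_div_one_sub_of_interval (by positivity) (by linarith)
  have hexp' : 1 / (1 - n / k : ℝ) ≤ 1 / (1 - ε ^ 2 / 4) := by
    apply one_div_le_one_div_of_le <;> linarith
  have hfin : 1 / (1 - ε ^ 2 / 4) ≤ 1 + 1 / 3 * ε ^ 2 := by
    rw [div_le_iff₀ (by linarith)]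
    nlinarith [sq_nonneg ε]
  linarith

end subToEvalLaw

/-! ### Medians of repeated estimates -/

theorem median_nonneg {l : List ℝ} (h : ∀ x ∈ l, 0 ≤ x) : 0 ≤ median l := by
  rw [median]
  by_cases hi : l.length / 2 < (l.insertionSort (· ≤ ·)).length
  · rw [List.getD_eq_getElem _ _ hi]
    exact h _ ((List.perm_insertionSort _ _).subset (List.getElem_mem hi))
  · rw [List.getD_eq_default _ _ (not_lt.1 hi)]

/-- `1 - p / q` if this is positive and `0` otherwise. -/
noncomputable def relDiff (p q : ℝ) : ℝ := if p < q then 1 - p / q else 0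

theorem relDiff_mem {p : ℝ} (hp : 0 ≤ p) (q : ℝ) : 0 ≤ relDiff p q ∧ relDiff p q ≤ 1 := by
  rw [relDiff]
  split_ifs with h
  · have hq : 0 < q := hp.trans_lt h
    have h1 : p / q ≤ 1 := (div_le_one hq).2 h.le
    have h2 : 0 ≤ p / q := by positivity
    constructor <;> linarith
  · simp

theorem relDiff_eq_max {p q : ℝ} (hq : 0 < q) : relDiff p q = max 0 (1 - p / q) := by
  rw [relDiff]
  split_ifs with h
  · rw [max_eq_right]
    linarith [(div_le_one hq).2 h.le]
  · rw [max_eq_left]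
    linarith [(one_le_div hq).2 (not_lt.1 h)]

/-- A multiplicative error in the ratio becomes an additive one because ratios above 1 all give 0,
and below 1 a factor a moves the ratio by at most a - 1. -/
theorem relDiff_le_add {p q p' q' a : ℝ} (hp : 0 ≤ p) (hq : 0 < q) (hq' : 0 < q') (ha : 1 ≤ a)
    (h : p' / q' ≤ a * (p / q)) : relDiff p q ≤ relDiff p' q' + (a - 1) := by
  rw [relDiff_eq_max hq, relDiff_eq_max hq']
  have h0 : 0 ≤ p / q := by positivity
  refine max_le (by linarith [le_max_left 0 (1 - p' / q')]) ?_
  rcases le_total (p / q) 1 with h1 | h1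
  · have : (a - 1) * (p / q) ≤ (a - 1) * 1 :=
      mul_le_mul_of_nonneg_left h1 (by linarith)
    linarith [le_max_right 0 (1 - p' / q')]
  · linarith [le_max_left 0 (1 - p' / q')]

theorem abs_relDiff_sub_le {ε p q p' q' : ℝ} (hε : 0 ≤ ε) (hε1 : ε < 1) (hp' : 0 ≤ p')
    (hq' : 0 < q') (hp : IsClose ε p' p) (hq : IsClose ε q' q) :
    |relDiff p q - relDiff p' q'| ≤ 2 * ε / (1 - ε) := by
  have h1 : 0 < 1 - ε := by linarith
  have hq0 : 0 < q := lt_of_lt_of_le (by positivity) hq.1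
  have hp0 : 0 ≤ p := le_trans (by positivity) hp.1
  obtain ⟨hpl, hpr⟩ := hp
  obtain ⟨hql, hqr⟩ := hq
  rw [div_le_iff₀ (by positivity)] at hpl hql
  rw [le_div_iff₀ h1] at hpr hqr
  have ha : (1 : ℝ) ≤ (1 + ε) / (1 - ε) := by
    rw [one_le_div h1]
    linarith
  have e : 2 * ε / (1 - ε) = (1 + ε) / (1 - ε) - 1 := by
    field_simp
    ring
  have r1 : p' / q' ≤ (1 + ε) / (1 - ε) * (p / q) := by
    rw [div_mul_div_comm, div_le_div_iff₀ hq' (by positivity)]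
    calc p' * ((1 - ε) * q) ≤ (p * (1 + ε)) * ((1 - ε) * q) := by gcongr
      _ = (p * (1 + ε)) * (q * (1 - ε)) := by ring
      _ ≤ (p * (1 + ε)) * q' := by gcongr
      _ = _ := by ring
  have r2 : p / q ≤ (1 + ε) / (1 - ε) * (p' / q') := by
    rw [div_mul_div_comm, div_le_div_iff₀ hq0 (by positivity)]
    calc p * ((1 - ε) * q') = (p * (1 - ε)) * q' := by ring
      _ ≤ p' * (q * (1 + ε)) := by gcongr
      _ = _ := by ring
  rw [abs_le, e]
  constructor
  · linarith [relDiff_le_add hp' hq' hq0 ha r2]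
  · linarith [relDiff_le_add hp0 hq0 hq' ha r1]

/-- The law of the result and the cost of repeatedly estimating two probabilities and comparing
the medians of the estimates. -/
noncomputable def compareLaw {n : ℕ} (p q : Fin n → ℝ) (k t : ℕ) : CostLaw ℝ :=
  CostLaw.bind (CostLaw.mapList (fun _ => CostLaw.bind (subToEvalLaw p k) fun x =>
    CostLaw.bind (subToEvalLaw q k) fun y => CostLaw.pure (x, y)) (List.range t)) fun l =>
      CostLaw.pure (relDiff (median (l.map Prod.fst)) (median (l.map Prod.snd)))

section compareLaw

variable {n : ℕ} {p q : Fin n → ℝ}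

theorem surely_compareLaw (p q : Fin n → ℝ) (k t : ℕ) :
    (compareLaw p q k t).Surely fun x => 0 ≤ x ∧ x ≤ 1 := by
  refine CostLaw.Surely.bind (CostLaw.Surely.mapList (s := fun x => 0 ≤ x.1) (fun _ => ?_) _)
    fun l hl => CostLaw.Surely.pure (relDiff_mem (median_nonneg ?_) _)
  · exact (surely_subToEvalLaw p k).bind fun x hx => (CostLaw.surely_true _).bind fun y _ =>
      CostLaw.Surely.pure hx
  · intro x hx
    obtain ⟨y, hy, rfl⟩ := List.mem_map.1 hx
    exact hl.2 y hy

theorem cost_compareLaw (hp : ∀ j, 0 < p j ∧ p j ≤ 1) (hq : ∀ j, 0 < q j ∧ q j ≤ 1) (k t : ℕ) :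
    (compareLaw p q k t).cost =
      t * (∑ j, ENNReal.ofReal (k / p j) + ∑ j, ENNReal.ofReal (k / q j)) := by
  simp only [compareLaw, CostLaw.cost_bind, CostLaw.cost_pure, CostLaw.value_const, add_zero,
    CostLaw.cost_mapList, cost_subToEvalLaw hp, cost_subToEvalLaw hq, List.map_const',
    List.sum_replicate, List.length_range, nsmul_eq_mul]

/-- When both medians are close, the ratio is off by at most a factor (1 + ε)/(1 - ε). Otherwise the
error is still at most 1, so the two failure probabilities simply add to the mean error. -/
theorem value_compareLaw_sub_le (hn : 1 ≤ n) (hp : ∀ j, 0 < p j ∧ p j ≤ 1)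
    (hq : ∀ j, 0 < q j ∧ q j ≤ 1) {ε : ℝ} (hε : 0 < ε) (hε1 : ε ≤ 1 / 2) (t : ℕ) :
    (compareLaw p q ⌈4 * (n : ℝ) / ε ^ 2⌉₊ t).value
      (fun x => ENNReal.ofReal |x - relDiff (∏ j, p j) (∏ j, q j)|) ≤
      ENNReal.ofReal (2 * ε / (1 - ε) + 2 * (17 / 18) ^ t) := by
  classical
  set k := ⌈4 * (n : ℝ) / ε ^ 2⌉₊
  set ν := CostLaw.bind (subToEvalLaw p k) fun x =>
    CostLaw.bind (subToEvalLaw q k) fun y => CostLaw.pure (x, y) with hν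
  have hν1 : ∀ f, ν.value (fun x => f x.1) = (subToEvalLaw p k).value f := fun f => by
    simp only [hν, CostLaw.value_bind, CostLaw.value_pure, CostLaw.value_const]
  have hν2 : ∀ f, ν.value (fun x => f x.2) = (subToEvalLaw q k).value f := fun f => by
    simp only [hν, CostLaw.value_bind, CostLaw.value_pure, CostLaw.value_const]
  have hbadp := CostLaw.value_half_bad_le ν (fun x => ¬ IsClose ε (∏ j, p j) x.1)
    ((hν1 fun e => if ¬ IsClose ε (∏ j, p j) e then 1 else 0).trans_le
      (value_not_isClose_le_third hn hp hε hε1)) (List.range t)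
  have hbadq := CostLaw.value_half_bad_le ν (fun x => ¬ IsClose ε (∏ j, q j) x.2)
    ((hν2 fun e => if ¬ IsClose ε (∏ j, q j) e then 1 else 0).trans_le
      (value_not_isClose_le_third hn hq hε hε1)) (List.range t)
  have hsure : (CostLaw.mapList (fun _ => ν) (List.range t)).Surely
      fun l => l.length = (List.range t).length ∧ ∀ x ∈ l, 0 ≤ x.1 :=
    CostLaw.Surely.mapList (s := fun x : ℝ × ℝ => 0 ≤ x.1) (fun _ => (surely_subToEvalLaw p k).bind fun x hx =>
      (CostLaw.surely_true _).bind fun y _ => CostLaw.Surely.pure hx) _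
  have hP : 0 ≤ ∏ j, p j := Finset.prod_nonneg fun j _ => (hp j).1.le
  have hQ : 0 < ∏ j, q j := Finset.prod_pos fun j _ => (hq j).1
  have h1ε : 0 < 1 - ε := by linarith
  rw [List.length_range] at hbadp hbadq hsure
  rw [compareLaw, CostLaw.value_bind]
  simp only [CostLaw.value_pure]
  calc _ ≤ (CostLaw.mapList (fun _ => ν) (List.range t)).value (fun l =>
        ENNReal.ofReal (2 * ε / (1 - ε)) +
          ((if t ≤ 2 * l.countP (fun x => ¬ IsClose ε (∏ j, p j) x.1) then 1 else 0) +
          (if t ≤ 2 * l.countP (fun x => ¬ IsClose ε (∏ j, q j) x.2) then 1 else 0))) := by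
        refine hsure.value_mono fun l hl => ?_
        have hone : ENNReal.ofReal |relDiff (median (l.map Prod.fst)) (median (l.map Prod.snd)) -
            relDiff (∏ j, p j) (∏ j, q j)| ≤ 1 := by
          rw [ENNReal.ofReal_le_one, abs_le]
          have h1 := relDiff_mem (p := median (l.map Prod.fst)) (median_nonneg (by
            intro x hx
            obtain ⟨y, hy, rfl⟩ := List.mem_map.1 hx
            exact hl.2 y hy)) (median (l.map Prod.snd))
          have h2 := relDiff_mem hP (∏ j, q j)
          constructor <;> linarith [h1.1, h1.2, h2.1, h2.2]
        split_ifs with h1 h2 h2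
        · exact hone.trans (le_add_left (by norm_num))
        · exact hone.trans (le_add_left (by norm_num))
        · exact hone.trans (le_add_left (by norm_num))
        · rw [add_zero, add_zero]
          refine ENNReal.ofReal_le_ofReal (abs_relDiff_sub_le hε.le (by linarith) hP hQ ?_ ?_)
          · refine median_mem_Icc ?_
            rw [List.countP_map, List.length_map, hl.1]
            refine lt_of_eq_of_lt ?_ (not_le.1 h1)
            exact congrArg _ (List.countP_congr fun x _ => by simp [IsClose])
          · refine median_mem_Icc ?_
            rw [List.countP_map, List.length_map, hl.1]
            refine lt_of_eq_of_lt ?_ (not_le.1 h2)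
            exact congrArg _ (List.countP_congr fun x _ => by simp [IsClose])
    _ ≤ ENNReal.ofReal (2 * ε / (1 - ε)) +
        (ENNReal.ofReal ((17 / 18) ^ t) + ENNReal.ofReal ((17 / 18) ^ t)) := by
        rw [CostLaw.value_add, CostLaw.value_const, CostLaw.value_add]
        gcongr
    _ = _ := by
        rw [← ENNReal.ofReal_add (by positivity) (by positivity),
          ← ENNReal.ofReal_add (by positivity) (by positivity), ← two_mul ((17 / 18 : ℝ) ^ t)]

end compareLaw

/-! ### The tamed distribution -/

/-- Mixing conditional probabilities of bits with uniform bits. -/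
noncomputable def tame {n : ℕ} (θ : ℝ) (K : Fin n → Cube n → Bool → ℝ) (j : Fin n) (σ : Cube n)
    (b : Bool) : ℝ :=
  (1 - 2 * θ) * K j σ b + θ

theorem run_drawMarginal {n : ℕ} (O : Source → Query n → PMF (Cube n)) (s : Source) (σ : Cube n)
    (j : Fin n) (c : Bool) :
    (drawMarginal s σ j).run O c = ENNReal.ofReal (condProb (O s) j σ c) := by
  rw [ofReal_condProb]
  rfl

/-- The uniform bit is used with probability 2θ and equals c half of the time, which contributes θ.
-/
theorem run_drawTamedMarginal {n : ℕ} (O : Source → Query n → PMF (Cube n)) {θ : ℝ} (h0 : 0 ≤ θ)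
    (h1 : θ ≤ 1 / 2) (s : Source) (σ : Cube n) (j : Fin n) (c : Bool) :
    (drawTamedMarginal θ s σ j).run O c = ENNReal.ofReal (tame θ (condProb (O s)) j σ c) := by
  have hmin : min 1 (2 * θ).toNNReal = (2 * θ).toNNReal :=
    min_eq_right (by rw [Real.toNNReal_le_one]; linarith)
  have hsub : ((1 - (2 * θ).toNNReal : ℝ≥0) : ℝ≥0∞) = ENNReal.ofReal (1 - 2 * θ) := by
    rw [ENNReal.coe_sub, ENNReal.coe_one, ENNReal.ofReal_sub _ (by linarith), ENNReal.ofReal_one]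
    rfl
  have hhalf : ∀ hp, OracleAlg.coinLaw (1 / 2) hp c = ENNReal.ofReal (1 / 2) := by
    intro hp
    have h2 : ((1 / 2 : ℝ≥0) : ℝ≥0∞) = ENNReal.ofReal (1 / 2) := by
      rw [ENNReal.ofReal]
      congr 1
      ext
      simp
    have h3 : (1 - 1 / 2 : ℝ≥0) = 1 / 2 := by
      ext
      rw [NNReal.coe_sub (by exact_mod_cast hp)]
      norm_num
    rw [OracleAlg.coinLaw, PMF.ofFintype_apply]
    cases c
    · simp only [Bool.false_eq_true, if_false, h3, h2]
    · simp only [if_true, h2]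
  have hrun : ∀ w : Cube n, OracleAlg.run O (.coin (min 1 (2 * θ).toNNReal) (min_le_left _ _)
      fun tamed => if tamed then .coin (1 / 2) (by norm_num) .done else .done (w j)) c =
      ENNReal.ofReal θ + ENNReal.ofReal (1 - 2 * θ) * if w j = c then 1 else 0 := by
    intro w
    rw [OracleAlg.run, PMF.apply_eq_expect, PMF.expect_bind, PMF.expect_bool _ true,
      ← PMF.apply_eq_expect, ← PMF.apply_eq_expect]
    simp only [if_true, Bool.not_true, Bool.false_eq_true, if_false, OracleAlg.run]
    have e1 : (OracleAlg.coinLaw (1 / 2 : ℝ≥0) (by norm_num)).bind (fun b => PMF.pure b) =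
      OracleAlg.coinLaw (1 / 2 : ℝ≥0) (by norm_num) := PMF.bind_pure _
    rw [e1, hhalf, OracleAlg.coinLaw, PMF.ofFintype_apply, PMF.ofFintype_apply, PMF.pure_apply]
    simp only [if_true, Bool.false_eq_true, if_false, hmin, hsub]
    congr 1
    · change ENNReal.ofReal (2 * θ) * _ = _
      rw [← ENNReal.ofReal_mul (by linarith)]
      congr 1
      ring
    · by_cases h : w j = c
      · rw [if_pos h, if_pos h.symm]
      · rw [if_neg h, if_neg (Ne.symm h)]
  rw [drawTamedMarginal, OracleAlg.run, PMF.bind_apply]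
  simp only [hrun]
  change PMF.expect _ _ = _
  rw [PMF.expect_add, PMF.expect_const, PMF.expect_const_mul, tame, add_comm,
    ENNReal.ofReal_add (mul_nonneg (by linarith) (condProb_nonneg _ _ _ _)) h0,
    ENNReal.ofReal_mul (by linarith), ofReal_condProb, PMF.apply_eq_expect, PMF.expect_map]

section tame

variable {n : ℕ} {θ : ℝ} {K : Fin n → Cube n → Bool → ℝ}

theorem PrefixDependent.tame (hK : PrefixDependent K) (θ : ℝ) : PrefixDependent (tame θ K) := by
  intro j σ τ h
  funext b
  rw [_root_.tame, _root_.tame, hK j σ τ h]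

theorem le_tame (h1 : θ ≤ 1 / 2) (hK0 : ∀ j σ b, 0 ≤ K j σ b) (j : Fin n) (σ : Cube n) (b : Bool) :
    θ ≤ tame θ K j σ b := by
  have := mul_nonneg (by linarith : 0 ≤ 1 - 2 * θ) (hK0 j σ b)
  rw [tame]
  linarith

theorem sum_tame (hK1 : ∀ j σ, ∑ b, K j σ b = 1) (j : Fin n) (σ : Cube n) :
    ∑ b, tame θ K j σ b = 1 := by
  have := hK1 j σ
  rw [Fintype.sum_bool] at this ⊢
  simp only [tame]
  linear_combination (1 - 2 * θ) * this

theorem sum_abs_sub_tame_le (h0 : 0 ≤ θ) (hK0 : ∀ j σ b, 0 ≤ K j σ b)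
    (hK1 : ∀ j σ, ∑ b, K j σ b = 1) (j : Fin n) (σ : Cube n) :
    ∑ b, |K j σ b - tame θ K j σ b| ≤ 2 * θ := by
  have h := hK1 j σ
  have ht := hK0 j σ true
  have hf := hK0 j σ false
  rw [Fintype.sum_bool] at h ⊢
  have : ∀ b, |K j σ b - tame θ K j σ b| ≤ θ := by
    intro b
    have e : K j σ b - tame θ K j σ b = θ * (2 * K j σ b - 1) := by
      rw [tame]
      ring
    rw [e, abs_mul, abs_of_nonneg h0]
    refine mul_le_of_le_one_right h0 (abs_le.2 ?_)
    cases b <;> constructor <;> linarith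
  linarith [this true, this false]

theorem sum_chain_eq_one {n : ℕ} {K : Fin n → Cube n → Bool → ℝ} (hK : PrefixDependent K)
    (h1 : ∀ j σ, ∑ b, K j σ b = 1) : ∑ σ : Cube n, ∏ j, K j σ (σ j) = 1 := by
  induction n with
  | zero => simp
  | succ n ih =>
    simp only [sum_cube_succ, prod_chain_cons hK fun _ => false, ← Finset.mul_sum]
    rw [← h1 0 fun _ => false]
    refine Finset.sum_congr rfl fun b _ => ?_
    rw [ih (hK.tail b) fun _ _ => h1 _ _, mul_one]

end tame

/-! ### Total variation distance -/

theorem sum_toReal_eq_one {n : ℕ} (D : PMF (Cube n)) : ∑ σ, (D σ).toReal = 1 := by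
  have h := D.tsum_coe
  rw [tsum_fintype] at h
  rw [← ENNReal.toReal_sum fun b _ => PMF.apply_ne_top _ _, h, ENNReal.toReal_one]

/-- The positive part is half of the absolute value plus half of the signed difference, and signed
differences cancel for equal total mass. -/
theorem sum_max_sub_eq {ι : Type*} [Fintype ι] {p q : ι → ℝ} (h : ∑ i, p i = ∑ i, q i) :
    ∑ i, max 0 (q i - p i) = 1 / 2 * ∑ i, |p i - q i| := by
  have e : ∀ i, max 0 (q i - p i) = 1 / 2 * |p i - q i| + (1 / 2 * q i - 1 / 2 * p i) := by
    intro i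
    rcases le_total (p i) (q i) with hi | hi
    · rw [max_eq_right (by linarith), abs_of_nonpos (by linarith)]
      ring
    · rw [max_eq_left (by linarith), abs_of_nonneg (by linarith)]
      ring
  simp only [e]
  rw [Finset.sum_add_distrib, Finset.sum_sub_distrib, ← Finset.mul_sum, ← Finset.mul_sum,
    ← Finset.mul_sum, h, sub_self, add_zero]

/-- The total variation distance to a tamed distribution. -/
theorem abs_sum_mul_relDiff_sub_tvDist_le {n : ℕ} {P Q : PMF (Cube n)}
    {A : Query n → PMF (Cube n)} (hA : IsSubcondOracle P A) {θ : ℝ} (h0 : 0 ≤ θ) (h1 : θ ≤ 1 / 2) :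
    |∑ σ, (Q σ).toReal * relDiff (∏ j, tame θ (condProb A) j σ (σ j)) (Q σ).toReal -
      tvDist P Q| ≤ n * θ := by
  set P' : Cube n → ℝ := fun σ => ∏ j, tame θ (condProb A) j σ (σ j) with hP'
  have hnn : ∀ j σ b, 0 ≤ tame θ (condProb A) j σ b := fun j σ b =>
    h0.trans (le_tame h1 (condProb_nonneg A) j σ b)
  have hP'0 : ∀ σ, 0 ≤ P' σ := fun σ => Finset.prod_nonneg fun j _ => hnn _ _ _
  have hP'1 : ∑ σ, P' σ = 1 :=
    sum_chain_eq_one ((prefixDependent_condProb A).tame θ) (sum_tame (sum_condProb A))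
  -- Multiplying by Q(σ) clears the denominator; at strings with Q(σ) = 0 both sides vanish because
  -- P' is nonnegative.
  have e : ∀ σ, (Q σ).toReal * relDiff (P' σ) (Q σ).toReal = max 0 ((Q σ).toReal - P' σ) := by
    intro σ
    rcases (ENNReal.toReal_nonneg (a := Q σ)).eq_or_lt with hq | hq
    · rw [← hq, zero_mul, max_eq_left]
      linarith [hP'0 σ]
    · rw [relDiff_eq_max hq, mul_max_of_nonneg _ _ hq.le, mul_zero, mul_sub, mul_one,
        mul_div_cancel₀ _ hq.ne']
  have hdist : ∑ σ, |(P σ).toReal - P' σ| ≤ n * (2 * θ) := by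
    simp only [← prod_condProb hA]
    exact sum_abs_chain_sub_le (prefixDependent_condProb A)
      ((prefixDependent_condProb A).tame θ) (condProb_nonneg A) hnn
      (fun j σ => (sum_condProb A j σ).le) (fun j σ => (sum_tame (sum_condProb A) j σ).le)
      (by linarith) (sum_abs_sub_tame_le h0 (condProb_nonneg A) (sum_condProb A))
  change |∑ σ, (Q σ).toReal * relDiff (P' σ) (Q σ).toReal - tvDist P Q| ≤ n * θ
  simp only [e]
  rw [sum_max_sub_eq (hP'1.trans (sum_toReal_eq_one Q).symm), tvDist, ← mul_sub,
    ← Finset.sum_sub_distrib, abs_mul, abs_of_nonneg (by norm_num : (0 : ℝ) ≤ 1 / 2)]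
  have hle : |∑ σ, (|P' σ - (Q σ).toReal| - |(P σ).toReal - (Q σ).toReal|)| ≤
      ∑ σ, |(P σ).toReal - P' σ| := by
    refine (Finset.abs_sum_le_sum_abs _ _).trans (Finset.sum_le_sum fun σ _ => ?_)
    refine (abs_abs_sub_abs_le_abs_sub _ _).trans (le_of_eq ?_)
    rw [abs_sub_comm]
    congr 1
    ring
  linarith

/-! ### The law of a round -/

theorem PMF.expect_sum {α ι : Type*} (μ : PMF α) (s : Finset ι) (f : ι → α → ℝ≥0∞) :
    μ.expect (fun a => ∑ i ∈ s, f i a) = ∑ i ∈ s, μ.expect (f i) := by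
  classical
  induction s using Finset.induction_on with
  | empty => simp [PMF.expect_const]
  | insert i s hi ih => simp only [Finset.sum_insert hi, PMF.expect_add, ih]

theorem PMF.expect_ofReal {α : Type*} [Fintype α] (μ : PMF α) {f : α → ℝ} (hf : ∀ a, 0 ≤ f a) :
    μ.expect (fun a => ENNReal.ofReal (f a)) = ENNReal.ofReal (∑ a, (μ a).toReal * f a) := by
  rw [PMF.expect, tsum_fintype,
    ENNReal.ofReal_sum_of_nonneg fun a _ => mul_nonneg ENNReal.toReal_nonneg (hf a)]
  refine Finset.sum_congr rfl fun a _ => ?_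
  rw [ENNReal.ofReal_mul ENNReal.toReal_nonneg, ENNReal.ofReal_toReal (PMF.apply_ne_top _ _)]

/-- This makes the loops for Q terminate almost surely: a string drawn from Q has no null bit along
its chain. -/
theorem condProb_pos {n : ℕ} {Q : PMF (Cube n)} {B : Query n → PMF (Cube n)}
    (hB : IsSubcondOracle Q B) {σ : Cube n} (hσ : σ ∈ Q.support) (j : Fin n) :
    0 < condProb B j σ (σ j) := by
  refine lt_of_le_of_ne (condProb_nonneg _ _ _ _) fun h => ?_
  have h0 : ∏ j, condProb B j σ (σ j) = 0 := Finset.prod_eq_zero (Finset.mem_univ j) h.symm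
  rw [prod_condProb hB, ENNReal.toReal_eq_zero_iff] at h0
  exact h0.elim ((PMF.mem_support_iff _ _).1 hσ) (PMF.apply_ne_top _ _)

/-- On average over the distribution itself, the inverse of the conditional probability of a bit
is the number of its possible values. -/
theorem expect_inv_condProb_le {n : ℕ} {Q : PMF (Cube n)} {B : Query n → PMF (Cube n)}
    (hB : IsSubcondOracle Q B) (j : Fin n) :
    Q.expect (fun σ => ENNReal.ofReal (1 / condProb B j σ (σ j))) ≤ 2 := by
  rw [PMF.expect_ofReal _ fun σ => one_div_nonneg.2 (condProb_nonneg _ _ _ _),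
    ← ENNReal.ofReal_ofNat]
  apply ENNReal.ofReal_le_ofReal
  -- Dividing Q(σ) by its j-th factor leaves the chain with that factor replaced by 1, whose sum
  -- over the j-th bit is 2. If the factor is 0, the convention 1/0 = 0 only makes the left side
  -- smaller.
  set K : Fin n → Cube n → Bool → ℝ := fun i σ b => if i = j then 1 else condProb B i σ b with hK
  have hle : ∀ σ, (Q σ).toReal * (1 / condProb B j σ (σ j)) ≤ ∏ i, K i σ (σ i) := by
    intro σ
    rw [← prod_condProb hB, ← Finset.mul_prod_erase _ _ (Finset.mem_univ j),
      ← Finset.mul_prod_erase _ (fun i => K i σ (σ i)) (Finset.mem_univ j)]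
    have e : ∏ i ∈ Finset.univ.erase j, K i σ (σ i) =
        ∏ i ∈ Finset.univ.erase j, condProb B i σ (σ i) :=
      Finset.prod_congr rfl fun i hi => if_neg (Finset.ne_of_mem_erase hi)
    rw [e, mul_right_comm, mul_one_div]
    refine mul_le_mul_of_nonneg_right ?_ (Finset.prod_nonneg fun i _ => condProb_nonneg _ _ _ _)
    simp only [hK, if_true]
    exact div_self_le_one _
  refine (Finset.sum_le_sum fun σ _ => hle σ).trans ?_
  refine (sum_chain_le (K := K) ?_ ?_ (c := fun i => if i = j then 2 else 1) ?_).trans ?_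
  · intro i σ τ h
    simp only [hK, prefixDependent_condProb B i σ τ h]
  · intro i σ b
    simp only [hK]
    split_ifs
    exacts [zero_le_one, condProb_nonneg _ _ _ _]
  · intro i σ
    simp only [hK]
    split_ifs
    · norm_num
    · exact (sum_condProb B i σ).le
  · rw [Finset.prod_ite_eq' Finset.univ j fun _ => (2 : ℝ), if_pos (Finset.mem_univ j)]

namespace SubVsSub

/-- The law of the result and the cost of a round. -/
noncomputable def roundLaw (n : ℕ) (γ : ℝ) (A B : Query n → PMF (Cube n)) (Q : PMF (Cube n)) :
    CostLaw ℝ :=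
  CostLaw.bind (Q.map fun σ => (σ, 1)) fun σ =>
    compareLaw (fun j => tame (γ / (2 * n)) (condProb A) j σ (σ j))
      (fun j => condProb B j σ (σ j)) ⌈4 * (n : ℝ) / (γ / 8) ^ 2⌉₊ (numRepeats γ)

section round

variable {n : ℕ} {γ : ℝ}

theorem tame_parameter_mem (hn : 1 ≤ n) (hγ : 0 < γ) (hγ' : γ ≤ 1 / 2) :
    0 < γ / (2 * n) ∧ γ / (2 * n) ≤ 1 / 2 := by
  have hn' : (1 : ℝ) ≤ n := by exact_mod_cast hn
  refine ⟨by positivity, ?_⟩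
  rw [div_le_iff₀ (by positivity)]
  linarith

theorem tame_mem (hn : 1 ≤ n) (hγ : 0 < γ) (hγ' : γ ≤ 1 / 2) (A : Query n → PMF (Cube n))
    (σ : Cube n) (j : Fin n) : 0 < tame (γ / (2 * n)) (condProb A) j σ (σ j) ∧
      tame (γ / (2 * n)) (condProb A) j σ (σ j) ≤ 1 := by
  obtain ⟨h0, h1⟩ := tame_parameter_mem hn hγ hγ'
  refine ⟨h0.trans_le (le_tame h1 (condProb_nonneg A) j σ _), ?_⟩
  rw [← sum_tame (θ := γ / (2 * n)) (sum_condProb A) j σ]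
  exact Finset.single_le_sum (f := fun b => tame (γ / (2 * n)) (condProb A) j σ b)
    (fun c _ => h0.le.trans (le_tame h1 (condProb_nonneg A) j σ c)) (Finset.mem_univ _)

theorem hasLaw_round (hn : 1 ≤ n) (hγ : 0 < γ) (hγ' : γ ≤ 1 / 2) {Q : PMF (Cube n)}
    {O : Source → Query n → PMF (Cube n)} (hQ : IsSubcondOracle Q (O Source.Q)) :
    HasLaw O (round n γ) (roundLaw n γ (O Source.P) (O Source.Q) Q) := by
  obtain ⟨h0, h1⟩ := tame_parameter_mem hn hγ hγ'
  have hrun : OracleAlg.run O (.query Source.Q (fun _ => none) .done) = Q := by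
    have huniv : subcube (fun _ => none : Query n) = Set.univ := by
      ext w
      simp [subcube]
    have hex : ∃ w ∈ subcube (fun _ => none : Query n), w ∈ Q.support := by
      obtain ⟨w, hw⟩ := Q.support_nonempty
      exact ⟨w, by rw [huniv]; trivial, hw⟩
    have : OracleAlg.run O (.query Source.Q (fun _ => none) .done) = O Source.Q fun _ => none :=
      PMF.bind_pure _
    rw [this, hQ _ hex]
    ext w
    rw [PMF.filter_apply, huniv, Set.indicator_univ, Q.tsum_coe, inv_one, mul_one]
  have hcall := HasLaw.call (O := O) (.query Source.Q (fun _ => none) .done)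
  rw [hrun] at hcall
  refine hcall.bind_of_support fun x hx => ?_
  obtain ⟨σ, hσ, rfl⟩ := (PMF.mem_support_map_iff _ _ _).1 hx
  refine (HasLaw.mapM' (fun _ => ?_) _).bind fun l => HasLaw.pure _
  refine (HasLaw.subToEval (tame_mem hn hγ hγ' _ σ) (fun j =>
    run_drawTamedMarginal O h0.le h1 _ _ _ _) _).bind fun p => ?_
  exact (HasLaw.subToEval (fun j => ⟨condProb_pos hQ hσ j, condProb_le_one _ _ _ _⟩) (fun j =>
    run_drawMarginal O _ _ _ _) _).bind fun q => HasLaw.pure _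

theorem surely_roundLaw (A B : Query n → PMF (Cube n)) (Q : PMF (Cube n)) :
    (roundLaw n γ A B Q).Surely fun x => 0 ≤ x ∧ x ≤ 1 :=
  (CostLaw.surely_true _).bind fun _ _ => surely_compareLaw _ _ _ _

/-- One query draws σ. In each repetition, the n loops for P' take at most k · 2n/γ draws each on
average by taming, and those for Q take at most 2k each on average over σ. -/
theorem cost_roundLaw_le (hn : 1 ≤ n) (hγ : 0 < γ) (hγ' : γ ≤ 1 / 2) {Q : PMF (Cube n)}
    (A : Query n → PMF (Cube n)) {B : Query n → PMF (Cube n)} (hB : IsSubcondOracle Q B) :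
    (roundLaw n γ A B Q).cost ≤ ENNReal.ofReal (numRepeats γ *
      (2 ^ 10 * (n : ℝ) ^ 3 / γ ^ 3 + 2 ^ 9 * (n : ℝ) ^ 2 / γ ^ 2)) := by
  have hn' : (1 : ℝ) ≤ n := by exact_mod_cast hn
  obtain ⟨h0, h1⟩ := tame_parameter_mem hn hγ hγ'
  set k := ⌈4 * (n : ℝ) / (γ / 8) ^ 2⌉₊ with hk
  set t := numRepeats γ with ht
  have ht1 : (1 : ℝ) ≤ t := by exact_mod_cast one_le_numRepeats hγ hγ'
  have hkle : (k : ℝ) ≤ 256 * n / γ ^ 2 + 1 := by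
    refine (Nat.ceil_lt_add_one (by positivity)).le.trans (le_of_eq ?_)
    field_simp
    ring
  have hp : ∀ σ j, ENNReal.ofReal (k / tame (γ / (2 * n)) (condProb A) j σ (σ j)) ≤
      ENNReal.ofReal (2 * n * k / γ) := by
    intro σ j
    apply ENNReal.ofReal_le_ofReal
    calc (k : ℝ) / tame (γ / (2 * n)) (condProb A) j σ (σ j) ≤ k / (γ / (2 * n)) := by
          gcongr
          exact le_tame h1 (condProb_nonneg A) j σ _
      _ = 2 * n * k / γ := by field_simp
  have hcost : (roundLaw n γ A B Q).cost ≤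
      1 + t * (n * ENNReal.ofReal (2 * n * k / γ) + n * (ENNReal.ofReal k * 2)) := by
    rw [roundLaw, CostLaw.cost_bind, CostLaw.cost, PMF.expect_map, CostLaw.value, PMF.expect_map]
    simp only [PMF.expect_const, Nat.cast_one]
    gcongr
    calc _ ≤ Q.expect (fun σ => t * (n * ENNReal.ofReal (2 * n * k / γ) +
          ∑ j, ENNReal.ofReal k * ENNReal.ofReal (1 / condProb B j σ (σ j)))) := by
          refine PMF.expect_mono_support _ fun σ hσ => ?_
          rw [cost_compareLaw (tame_mem hn hγ hγ' A σ)
            (fun j => ⟨condProb_pos hB hσ j, condProb_le_one _ _ _ _⟩)]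
          refine mul_le_mul_right (add_le_add ?_ ?_) _
          · refine (Finset.sum_le_sum fun j _ => hp σ j).trans ?_
            rw [Finset.sum_const, Finset.card_univ, Fintype.card_fin, nsmul_eq_mul]
          · refine Finset.sum_le_sum fun j _ => ?_
            rw [← ENNReal.ofReal_mul (by positivity), mul_one_div]
      _ = t * (n * ENNReal.ofReal (2 * n * k / γ) + ∑ j, ENNReal.ofReal k *
          Q.expect fun σ => ENNReal.ofReal (1 / condProb B j σ (σ j))) := by
          rw [PMF.expect_const_mul, PMF.expect_add, PMF.expect_const, PMF.expect_sum]
          simp only [PMF.expect_const_mul]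
      _ ≤ _ := by
          gcongr
          refine (Finset.sum_le_sum fun j _ =>
            mul_le_mul_right (expect_inv_condProb_le hB j) _).trans ?_
          rw [Finset.sum_const, Finset.card_univ, Fintype.card_fin, nsmul_eq_mul]
  refine hcost.trans ?_
  have e : (1 + t * (n * ENNReal.ofReal (2 * n * k / γ) + n * (ENNReal.ofReal k * 2)) : ℝ≥0∞) =
      ENNReal.ofReal (1 + t * (n * (2 * n * k / γ) + n * (k * 2))) := by
    rw [ENNReal.ofReal_add (by positivity) (by positivity), ENNReal.ofReal_mul (by positivity),
      ENNReal.ofReal_add (by positivity) (by positivity), ENNReal.ofReal_mul (by positivity),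
      ENNReal.ofReal_mul (by positivity), ENNReal.ofReal_mul (by positivity)]
    simp
  rw [e]
  apply ENNReal.ofReal_le_ofReal
  set g := 1 / γ with hg
  have hg2 : 2 ≤ g := by
    rw [hg, le_div_iff₀ hγ]
    linarith
  -- Inserting k ≤ 256 n/γ² + 1 gives 512 (n/γ)³ + 512 n²/γ² plus lower terms; the second half of
  -- the 2^10 absorbs these and the initial query.
  have hbase : (1 : ℝ) + (n * (2 * n * k / γ) + n * (k * 2)) ≤
      2 ^ 10 * (n : ℝ) ^ 3 / γ ^ 3 + 2 ^ 9 * (n : ℝ) ^ 2 / γ ^ 2 := by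
    have e1 : (2 : ℝ) ^ 10 * (n : ℝ) ^ 3 / γ ^ 3 + 2 ^ 9 * (n : ℝ) ^ 2 / γ ^ 2 =
        1024 * (n * g) ^ 3 + 512 * (n * g) ^ 2 := by
      rw [hg]
      field_simp
      ring
    have e2 : (n * (2 * n * k / γ) + n * (k * 2) : ℝ) = (2 * n ^ 2 * g + 2 * n) * k := by
      rw [hg]
      field_simp
    have e3 : (256 * n / γ ^ 2 + 1 : ℝ) = 256 * n * g ^ 2 + 1 := by
      rw [hg]
      field_simp
    rw [e1, e2]
    rw [e3] at hkle
    have hng : 2 ≤ n * g := by nlinarith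
    have h4 : (n : ℝ) ≤ n * g := by nlinarith
    have h5 : (n : ℝ) ^ 2 * g ≤ (n * g) ^ 2 := by
      have : (n * g) ^ 2 = n ^ 2 * g * g := by ring
      rw [this]
      have : (0 : ℝ) ≤ n ^ 2 * g := by positivity
      nlinarith
    have h6 : 2 * (n * g) ^ 2 ≤ (n * g) ^ 3 := by
      rw [pow_succ (n * g : ℝ) 2]
      nlinarith [sq_nonneg (n * g : ℝ)]
    have h7 : 2 * (n * g) ≤ (n * g : ℝ) ^ 2 := by nlinarith
    calc (1 : ℝ) + (2 * n ^ 2 * g + 2 * n) * k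
        ≤ 1 + (2 * n ^ 2 * g + 2 * n) * (256 * n * g ^ 2 + 1) := by gcongr
      _ = 1 + 512 * (n * g) ^ 3 + 512 * (n * g) ^ 2 + 2 * (n ^ 2 * g) + 2 * n := by ring
      _ ≤ _ := by nlinarith
  calc (1 : ℝ) + t * (n * (2 * n * k / γ) + n * (k * 2))
      ≤ t * 1 + t * (n * (2 * n * k / γ) + n * (k * 2)) := by linarith
    _ = t * (1 + (n * (2 * n * k / γ) + n * (k * 2))) := by ring
    _ ≤ _ := by gcongr

/-- From t ≥ 48 log(10m) one gets e^(-t/18) ≤ 1/(10m), and m ≥ 32/γ² makes this at most γ²/320. -/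
theorem pow_numRepeats_le (hγ : 0 < γ) (hγ' : γ ≤ 1 / 2) :
    ((17 : ℝ) / 18) ^ numRepeats γ ≤ γ / 640 := by
  have hm := le_numSamples hγ
  have hm0 : (0 : ℝ) < numSamples γ := lt_of_lt_of_le (by positivity) hm
  have h1 : (1 : ℝ) ≤ 32 / γ ^ 2 := by
    rw [le_div_iff₀ (by positivity)]
    nlinarith
  have hlog : 0 ≤ Real.log (10 * numSamples γ) := Real.log_nonneg (by linarith)
  calc ((17 : ℝ) / 18) ^ numRepeats γ ≤ Real.exp (-(1 / 18)) ^ numRepeats γ := by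
        gcongr
        linarith [Real.add_one_le_exp (-(1 / 18) : ℝ)]
    _ = Real.exp (-(numRepeats γ / 18)) := by
        rw [← Real.exp_nat_mul]
        congr 1
        ring
    _ ≤ Real.exp (-Real.log (10 * numSamples γ)) := by
        apply Real.exp_le_exp.2
        linarith [le_numRepeats γ]
    _ = 1 / (10 * numSamples γ) := by rw [Real.exp_neg, Real.exp_log (by positivity), one_div]
    _ ≤ 1 / (10 * (32 / γ ^ 2)) := by gcongr
    _ = γ * γ / 320 := by field_simp; norm_num
    _ ≤ γ / 640 := by nlinarith

/-- The expected result of a round is close to the total variation distance. -/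
theorem exists_value_roundLaw (hn : 1 ≤ n) (hγ : 0 < γ) (hγ' : γ ≤ 1 / 2) {P Q : PMF (Cube n)}
    {A B : Query n → PMF (Cube n)} (hA : IsSubcondOracle P A) (hB : IsSubcondOracle Q B) :
    ∃ e : ℝ, 0 ≤ e ∧ (roundLaw n γ A B Q).value ENNReal.ofReal = ENNReal.ofReal e ∧
      |e - tvDist P Q| ≤ 77 / 100 * γ := by
  have hn' : (1 : ℝ) ≤ n := by exact_mod_cast hn
  obtain ⟨h0, h1⟩ := tame_parameter_mem hn hγ hγ'
  set r : Cube n → ℝ := fun σ =>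
    relDiff (∏ j, tame (γ / (2 * n)) (condProb A) j σ (σ j)) (Q σ).toReal with hr
  set c : Cube n → CostLaw ℝ := fun σ =>
    compareLaw (fun j => tame (γ / (2 * n)) (condProb A) j σ (σ j))
      (fun j => condProb B j σ (σ j)) ⌈4 * (n : ℝ) / (γ / 8) ^ 2⌉₊ (numRepeats γ) with hc
  set η : ℝ := 2 * (γ / 8) / (1 - γ / 8) + 2 * (17 / 18) ^ numRepeats γ with hη
  have h1γ : 0 < 1 - γ / 8 := by linarith
  have hη0 : 0 ≤ η := by positivity
  -- Since γ ≤ 1/2, the denominator 1 - γ/8 is at least 15/16, and (1/4)(16/15) = 4/15.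
  have hηle : η ≤ 4 / 15 * γ + γ / 320 := by
    have h2 : 2 * (γ / 8) / (1 - γ / 8) ≤ 4 / 15 * γ := by
      rw [div_le_iff₀ h1γ]
      nlinarith
    linarith [pow_numRepeats_le hγ hγ']
  have hr0 : ∀ σ, 0 ≤ r σ := fun σ =>
    (relDiff_mem (Finset.prod_nonneg fun j _ => (tame_mem hn hγ hγ' A σ j).1.le) _).1
  have hdev : ∀ σ ∈ Q.support,
      (c σ).value (fun x => ENNReal.ofReal |x - r σ|) ≤ ENNReal.ofReal η := by
    intro σ hσ
    have := value_compareLaw_sub_le hn (tame_mem hn hγ hγ' A σ)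
      (fun j => ⟨condProb_pos hB hσ j, condProb_le_one B j σ (σ j)⟩) (ε := γ / 8) (by positivity)
      (by linarith) (numRepeats γ)
    rwa [prod_condProb hB] at this
  have hval : (roundLaw n γ A B Q).value ENNReal.ofReal =
      Q.expect fun σ => (c σ).value ENNReal.ofReal := by
    rw [roundLaw, CostLaw.value_bind, CostLaw.value, PMF.expect_map]
  set D := ∑ σ, (Q σ).toReal * r σ with hD
  have hD0 : 0 ≤ D := Finset.sum_nonneg fun σ _ => mul_nonneg ENNReal.toReal_nonneg (hr0 σ)
  have hDval : Q.expect (fun σ => ENNReal.ofReal (r σ)) = ENNReal.ofReal D :=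
    PMF.expect_ofReal _ hr0
  have hup : (roundLaw n γ A B Q).value ENNReal.ofReal ≤ ENNReal.ofReal (D + η) := by
    rw [hval, ENNReal.ofReal_add hD0 hη0, ← hDval, ← PMF.expect_const Q (ENNReal.ofReal η),
      ← PMF.expect_add]
    refine PMF.expect_mono_support _ fun σ hσ => ?_
    refine le_trans ?_ (add_le_add_right (hdev σ hσ) _)
    rw [← CostLaw.value_const (c σ) (ENNReal.ofReal (r σ)), ← CostLaw.value_add]
    refine CostLaw.value_mono _ fun x => ?_
    rw [← ENNReal.ofReal_add (hr0 σ) (abs_nonneg _)]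
    exact ENNReal.ofReal_le_ofReal (by linarith [le_abs_self (x - r σ)])
  -- The error stands on the larger side, since subtraction in `ℝ≥0∞` truncates.
  have hlow : ENNReal.ofReal D ≤
      (roundLaw n γ A B Q).value ENNReal.ofReal + ENNReal.ofReal η := by
    rw [hval, ← hDval, ← PMF.expect_const Q (ENNReal.ofReal η), ← PMF.expect_add]
    refine PMF.expect_mono_support _ fun σ hσ => ?_
    refine le_trans ?_ (add_le_add_right (hdev σ hσ) _)
    rw [← CostLaw.value_const (c σ) (ENNReal.ofReal (r σ)), ← CostLaw.value_add]
    refine CostLaw.value_mono _ fun x => ?_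
    refine le_trans (ENNReal.ofReal_le_ofReal ?_) ENNReal.ofReal_add_le
    linarith [neg_abs_le (x - r σ)]
  have htop : (roundLaw n γ A B Q).value ENNReal.ofReal ≠ ⊤ :=
    ne_top_of_le_ne_top ENNReal.ofReal_ne_top hup
  refine ⟨((roundLaw n γ A B Q).value ENNReal.ofReal).toReal, ENNReal.toReal_nonneg,
    (ENNReal.ofReal_toReal htop).symm, ?_⟩
  set e := ((roundLaw n γ A B Q).value ENNReal.ofReal).toReal with he
  have he0 : 0 ≤ e := ENNReal.toReal_nonneg
  rw [← ENNReal.ofReal_toReal htop, ← he] at hup hlow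
  rw [ENNReal.ofReal_le_ofReal_iff (by linarith)] at hup
  rw [← ENNReal.ofReal_add he0 hη0, ENNReal.ofReal_le_ofReal_iff (by linarith)] at hlow
  have htv := abs_sum_mul_relDiff_sub_tvDist_le (Q := Q) hA h0.le h1
  have hnθ : n * (γ / (2 * n)) = γ / 2 := by field_simp
  rw [hnθ, abs_le] at htv
  rw [abs_le]
  -- The bias adds up to 1/2 + 4/15 + 1/320 < 77/100, in units of γ.
  constructor <;> linarith [htv.1, htv.2]

end round

/-! ### The tester -/

/-- The law of the result and the cost of the estimate. -/
noncomputable def estimateLaw (n : ℕ) (γ : ℝ) (A B : Query n → PMF (Cube n)) (Q : PMF (Cube n)) :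
    CostLaw ℝ :=
  CostLaw.bind (CostLaw.mapList (fun _ => roundLaw n γ A B Q) (List.range (numSamples γ)))
    fun Γ => CostLaw.pure (Γ.sum / numSamples γ)

section estimate

variable {n : ℕ} {γ : ℝ}

theorem hasLaw_estimate (hn : 1 ≤ n) (hγ : 0 < γ) (hγ' : γ ≤ 1 / 2) {Q : PMF (Cube n)}
    {O : Source → Query n → PMF (Cube n)} (hQ : IsSubcondOracle Q (O Source.Q)) :
    HasLaw O (estimate n γ) (estimateLaw n γ (O Source.P) (O Source.Q) Q) :=
  (HasLaw.mapM' (fun _ => hasLaw_round hn hγ hγ' hQ) _).bind fun _ => HasLaw.pure _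

theorem cost_estimateLaw_le (hn : 1 ≤ n) (hγ : 0 < γ) (hγ' : γ ≤ 1 / 2) {Q : PMF (Cube n)}
    (A : Query n → PMF (Cube n)) {B : Query n → PMF (Cube n)} (hB : IsSubcondOracle Q B) :
    (estimateLaw n γ A B Q).cost ≤ ENNReal.ofReal (callBound n γ / 10) := by
  simp only [estimateLaw, CostLaw.cost_bind, CostLaw.cost_pure, CostLaw.value_const, add_zero,
    CostLaw.cost_mapList, List.map_const', List.sum_replicate, List.length_range, nsmul_eq_mul]
  refine (mul_le_mul_right (cost_roundLaw_le hn hγ hγ' A hB) _).trans (le_of_eq ?_)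
  rw [← ENNReal.ofReal_natCast, ← ENNReal.ofReal_mul (Nat.cast_nonneg _), callBound]
  congr 1
  ring

/-- The deviation 23/100 is what the bias 77/100 leaves of γ. With m ≥ 32/γ², the bound 1/(4mδ²) is
1/(128 · 0.23²) < 3/20. -/
theorem value_estimateLaw_deviation_le (hγ : 0 < γ) (hγ' : γ ≤ 1 / 2) {Q : PMF (Cube n)}
    {A B : Query n → PMF (Cube n)} {e : ℝ} (he : 0 ≤ e)
    (h : (roundLaw n γ A B Q).value ENNReal.ofReal = ENNReal.ofReal e) :
    (estimateLaw n γ A B Q).value (fun z => if 23 / 100 * γ ≤ |z - e| then 1 else 0) ≤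
      ENNReal.ofReal (3 / 20) := by
  have hm := le_numSamples hγ
  have hm0 : (0 : ℝ) < numSamples γ := lt_of_lt_of_le (by positivity) hm
  have hl : List.range (numSamples γ) ≠ [] := by
    rw [Ne, List.range_eq_nil]
    exact_mod_cast hm0.ne'
  have hdev := CostLaw.value_mean_deviation_le (surely_roundLaw A B Q) he h
    (δ := 23 / 100 * γ) (by positivity) (List.range (numSamples γ)) hl
  rw [List.length_range] at hdev
  simp only [estimateLaw, CostLaw.value_bind, CostLaw.value_pure]
  refine hdev.trans (ENNReal.ofReal_le_ofReal ?_)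
  rw [div_le_iff₀ (by positivity)]
  rw [div_le_iff₀ (by positivity)] at hm
  nlinarith

end estimate

/-- Failure requires exhausting the budget (probability at most 1/10) or a deviating mean (at most
3/20). The sum 1/4 is below the permitted 2/5. The hypothesis `hv` treats both verdicts at once. -/
theorem three_fifths_le_run {n : ℕ} (hn : 1 ≤ n) {ε₁ ε₂ : ℝ} (h0 : 0 ≤ ε₁) (h12 : ε₁ < ε₂)
    (h2 : ε₂ ≤ 1) {P Q : PMF (Cube n)} {O : Source → Query n → PMF (Cube n)}
    (hP : IsSubcondOracle P (O Source.P)) (hQ : IsSubcondOracle Q (O Source.Q)) (v : Verdict)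
    (hv : ∀ z b, |z - tvDist P Q| < gap ε₁ ε₂ → verdictOf ε₁ ε₂ (some (z, b)) = v) :
    3 / 5 ≤ (subVsSub n ε₁ ε₂).run O v := by
  classical
  set γ := gap ε₁ ε₂ with hγdef
  have hγ : 0 < γ := by
    rw [hγdef, gap]
    linarith
  have hγ' : γ ≤ 1 / 2 := by
    rw [hγdef, gap]
    linarith
  have hn' : (1 : ℝ) ≤ n := by exact_mod_cast hn
  obtain ⟨e, he0, he, hetv⟩ := exists_value_roundLaw hn hγ hγ' hP hQ
  set μ := estimateLaw n γ (O Source.P) (O Source.Q) Q with hμ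
  set M := callBound n γ with hM
  have hMpos : 0 < M := by
    have hm0 : (0 : ℝ) < numSamples γ := lt_of_lt_of_le (by positivity) (le_numSamples hγ)
    have ht0 : (0 : ℝ) < numRepeats γ := by exact_mod_cast one_le_numRepeats hγ hγ'
    rw [hM, callBound]
    positivity
  set B := ⌊M⌋₊ with hB
  have hrun : (subVsSub n ε₁ ε₂).run O =
      μ.map fun p => verdictOf ε₁ ε₂ (chargeBudget B p) := by
    rw [subVsSub_eq, OracleAlg.run_bind, hasLaw_estimate hn hγ hγ' hQ, PMF.bind_map]
    rfl
  -- Markov's inequality with expected cost at most M/10: a cost beyond ⌊M⌋ is at least ⌊M⌋ + 1,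
  -- hence at least M.
  have hcost : μ.expect (fun p => if B + 1 ≤ p.2 then 1 else 0) ≤ ENNReal.ofReal (1 / 10) := by
    have h3 := μ.expect_indicator_le (fun p => B + 1 ≤ p.2) (fun p => (p.2 : ℝ≥0∞))
      (ENNReal.ofReal M) (by
        intro p hp
        rw [← ENNReal.ofReal_natCast]
        apply ENNReal.ofReal_le_ofReal
        refine (Nat.lt_floor_add_one M).le.trans ?_
        exact_mod_cast hp)
    have h4 := h3.trans (cost_estimateLaw_le hn hγ hγ' (O Source.P) hQ)
    rw [show callBound n γ / 10 = 1 / 10 * M by rw [hM]; ring,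
      ENNReal.ofReal_mul (by norm_num)] at h4
    exact (ENNReal.mul_le_mul_iff_left (by simpa using hMpos) ENNReal.ofReal_ne_top).1 h4
  have hdev : μ.expect (fun p => if 23 / 100 * γ ≤ |p.1 - e| then 1 else 0) ≤
      ENNReal.ofReal (3 / 20) := value_estimateLaw_deviation_le hγ hγ' he0 he
  have hbad : μ.expect (fun p => if verdictOf ε₁ ε₂ (chargeBudget B p) = v then 0 else 1) ≤
      2 / 5 := by
    calc _ ≤ μ.expect (fun p => (if B + 1 ≤ p.2 then 1 else 0) +
          if 23 / 100 * γ ≤ |p.1 - e| then 1 else 0) := by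
          refine PMF.expect_mono _ fun p => ?_
          by_cases h5 : B + 1 ≤ p.2
          · rw [if_pos h5]
            refine le_trans ?_ le_self_add
            split_ifs <;> simp
          by_cases h6 : 23 / 100 * γ ≤ |p.1 - e|
          · rw [if_pos h6]
            refine le_trans ?_ le_add_self
            split_ifs <;> simp
          rw [if_pos]
          · exact zero_le
          · rw [chargeBudget, if_pos (by omega)]
            apply hv
            calc |p.1 - tvDist P Q| ≤ |p.1 - e| + |e - tvDist P Q| := abs_sub_le _ _ _
              _ < γ := by linarith [not_le.1 h6]
      _ ≤ ENNReal.ofReal (1 / 10) + ENNReal.ofReal (3 / 20) := by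
          rw [PMF.expect_add]
          gcongr
      _ ≤ ENNReal.ofReal (2 / 5) := by
          rw [← ENNReal.ofReal_add (by norm_num) (by norm_num)]
          exact ENNReal.ofReal_le_ofReal (by norm_num)
      _ = 2 / 5 := by
          rw [ENNReal.ofReal_div_of_pos (by norm_num)]
          simp
  have hgood : (subVsSub n ε₁ ε₂).run O v =
      μ.expect fun p => if verdictOf ε₁ ε₂ (chargeBudget B p) = v then 1 else 0 := by
    rw [PMF.apply_eq_expect, hrun, PMF.expect_map]
  have htot : (subVsSub n ε₁ ε₂).run O v +
      μ.expect (fun p => if verdictOf ε₁ ε₂ (chargeBudget B p) = v then 0 else 1) = 1 := by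
    rw [hgood, ← PMF.expect_add]
    refine Eq.trans (congrArg μ.expect (funext fun p => ?_)) (PMF.expect_const μ 1)
    split_ifs <;> simp
  have hsum : (3 / 5 : ℝ≥0∞) + 2 / 5 = 1 := by
    rw [← ENNReal.add_div]
    norm_num
    exact ENNReal.div_self (by norm_num) (by norm_num)
  have h25 : (2 / 5 : ℝ≥0∞) ≠ ⊤ := ENNReal.div_ne_top (by norm_num) (by norm_num)
  have hle : (3 / 5 : ℝ≥0∞) + 2 / 5 ≤ (subVsSub n ε₁ ε₂).run O v + 2 / 5 := by
    rw [hsum, ← htot]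
    gcongr
  exact (ENNReal.add_le_add_iff_right h25).1 hle

end SubVsSub

theorem theorem1 :
    ∃ (C : ℝ) (c : ℕ), ∀ (n : ℕ) (ε₁ ε₂ : ℝ), 1 ≤ n → 0 ≤ ε₁ → ε₁ < ε₂ → ε₂ ≤ 1 →
      ((subVsSub n ε₁ ε₂).maxQueries : ℝ) ≤
          C * ((n : ℝ) ^ 3 / (ε₂ - ε₁) ^ 5) *
            Real.log (2 + (n : ℝ) ^ 3 / (ε₂ - ε₁) ^ 5) ^ c ∧
      ∀ (P Q : PMF (Cube n)) (O : Source → Query n → PMF (Cube n)),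
        IsSubcondOracle P (O Source.P) → IsSubcondOracle Q (O Source.Q) →
          (tvDist P Q < ε₁ → 3 / 5 ≤ (subVsSub n ε₁ ε₂).run O Verdict.accept) ∧
          (ε₂ < tvDist P Q → 3 / 5 ≤ (subVsSub n ε₁ ε₂).run O Verdict.reject) := by
  refine ⟨10 ^ 11, 1, fun n ε₁ ε₂ hn h0 h12 h2 => ⟨?_, fun P Q O hP hQ => ⟨fun h => ?_,
    fun h => ?_⟩⟩⟩
  · refine le_trans ?_ (SubVsSub.callBound_le hn h0 h12 h2)
    refine le_trans (Nat.cast_le.2 (maxQueries_subVsSub_le n ε₁ ε₂)) (Nat.floor_le ?_)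
    have hγ : 0 < SubVsSub.gap ε₁ ε₂ := by
      rw [SubVsSub.gap]
      linarith
    rw [SubVsSub.callBound]
    positivity
  · refine SubVsSub.three_fifths_le_run hn h0 h12 h2 hP hQ _ fun z b hz => ?_
    rw [SubVsSub.gap, abs_lt] at hz
    exact if_pos (by linarith [hz.2])
  · refine SubVsSub.three_fifths_le_run hn h0 h12 h2 hP hQ _ fun z b hz => ?_
    rw [SubVsSub.gap, abs_lt] at hz
    exact if_neg (by linarith [hz.1])
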